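/- Fix $n\ge 1$ and $\rho\in(-1,1)$. For each $d\ge 1$ let $W_Q,W_K$ be random $d\times d$ matrices such that $W=W_QW_K^T$ has i.i.d. $\mathcal N(0,1)$ entries, let $X,Z\in\mathbb R^{n\times d}$ have i.i.d. $\mathcal N(0,1)$ entries, with $W,X,Z$ independent, and put $Y=\rho X+\sqrt{1-\rho^2}\,Z$. For a deterministic $W_V\in\mathbb R^{d\times d}$ let $f(X)=\sigma(XWX^T)\,XW_V$, where $\sigma$ is the row-wise softmax (without $1/\sqrt d$ scaling). For $|c|<1$ let $f_c(x,y)=\frac{1}{2\pi\sqrt{1-c^2}}\exp\left(-\frac{x^2-2cxy+y^2}{2(1-c^2)}\right)$ and $\Phi_c(x,y)=\int_{-\infty}^x\int_{-\infty}^y f_c(u,v)\,dv\,du$ be the density and the distribution function of the standard bivariate normal law with correlation $c$, and let $$s(\rho)=n\int_{-\infty}^{\infty}\int_{-\infty}^{\infty}\Phi_{\rho^2}(x,y)^{n-1}f_{\rho^2}(x,y)\,dx\,dy .$$ Then, as $d\to\infty$ with $n,\rho$ fixed, for every $i\in[n]$: 1. With probability tending to $1$ the $i$-th row of $XWX^T$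 has a unique maximal entry, at position $k$ say, and the $i$-th row of $\sigma(XWX^T)$ converges in probability to the indicator vector $e_k$, i.e. for every $\varepsilon>0$ the probability that $k$ is unique and all entries of the difference are less than $\varepsilon$ in absolute value tends to $1$. Attention therefore acts as the selection of the single token $k$: $f(X)_{ij}-(XW_V)_{kj}\to 0$ in probability, uniformly over all $j\in[d]$ and all $W_V$ with $\|(W_V)_{:,j}\|_2\le B$, for every fixed $B$. The same holds with $Y$ in place of $X$. 2. The probability that the $i$-th rows of $XWX^T$ and $YWY^T$ have their (unique) maxima at the same position tends to $s(\rho)$. 3. For every $B>0$, uniformly over all $j\in[d]$ and all $W_V$ with $\|(W_V)_{:,j}\|_2\le B$, the product $f(X)_{ij}f(Y)_{ij}$ is integrable and $$\mathbb E\left[f(X)_{ij}f(Y)_{ij}\right]=\rho\, s(\rho)\,\|(W_V)_{:,j}\|_2^2+o(1).$$ 4. For given weights, $X\mapsto f(X)_{ij}$ is square integrable for the Gaussian measure, and the noise stability for given $W$ satisfies, in probability over $W$ and (for every $B>0$) uniformly over all $j\in[d]$ and all $W_V$ with $\|(W_V)_{:,j}\|_2\le B$, $$\mathbb E\left[f(X)_{ij}f(Y)_{ij}\mid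 W\right]=\rho\, s(\rho)\,\|(W_V)_{:,j}\|_2^2+o_p(1).$$ -/

import Mathlib

open MeasureTheory ProbabilityTheory Filter Topology
open scoped Matrix

noncomputable section

/-- The product (Borel) σ-algebra on real matrices. -/
instance instMeasurableSpaceRealMatrix {m k : ℕ} : MeasurableSpace (Matrix (Fin m) (Fin k) ℝ) :=
  inferInstanceAs (MeasurableSpace (Fin m → Fin k → ℝ))

/-- The law of an `n × d` random matrix with independent standard Gaussian entries. -/
def stdGaussianMatrix (n d : ℕ) : Measure (Matrix (Fin n) (Fin d) ℝ) :=
  Measure.pi fun _ => Measure.pi fun _ => gaussianReal 0 1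

/-- The softmax of a finite vector. -/
def softmax {n : ℕ} (v : Fin n → ℝ) : Fin n → ℝ :=
  fun k => Real.exp (v k) / ∑ l, Real.exp (v l)

/-- The score matrix `X W_Q W_Kᵀ Xᵀ`; its `(i, j)` entry is `x_iᵀ W x_j` with `W = W_Q W_Kᵀ`. -/
def scores {n d : ℕ} (WQ WK : Matrix (Fin d) (Fin d) ℝ) (X : Matrix (Fin n) (Fin d) ℝ) :
    Matrix (Fin n) (Fin n) ℝ :=
  X * (WQ * WKᵀ) * Xᵀ

/-- The attention matrix: the softmax applied to each row of the score matrix. -/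
def attentionMatrix {n d : ℕ} (WQ WK : Matrix (Fin d) (Fin d) ℝ)
    (X : Matrix (Fin n) (Fin d) ℝ) : Matrix (Fin n) (Fin n) ℝ :=
  Matrix.of fun i => softmax (scores WQ WK X i)

/-- The attention layer `f(X) = σ(X W_Q W_Kᵀ Xᵀ) X W_V`. -/
def attention {n d : ℕ} (WQ WK WV : Matrix (Fin d) (Fin d) ℝ)
    (X : Matrix (Fin n) (Fin d) ℝ) : Matrix (Fin n) (Fin d) ℝ :=
  attentionMatrix WQ WK X * (X * WV)

/-- `k` is the argmax of `v`: the maximum is attained at `k` and nowhere else. -/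
def IsArgmax {n : ℕ} (v : Fin n → ℝ) (k : Fin n) : Prop :=
  ∀ j, j ≠ k → v j < v k

/-- The Euclidean norm of the `j`-th column of a matrix. -/
def colNorm {d : ℕ} (M : Matrix (Fin d) (Fin d) ℝ) (j : Fin d) : ℝ :=
  ‖(WithLp.toLp 2 (fun a => M a j) : EuclideanSpace ℝ (Fin d))‖

/-- Gaussian noise stability `E[g(X) g(Y)]`, where `Y = ρ X + √(1 - ρ²) Z` and `X`, `Z` are
independent standard Gaussian matrices. -/
def noiseStability {n d : ℕ} (ρ : ℝ) (g : Matrix (Fin n) (Fin d) ℝ → ℝ) : ℝ :=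
  ∫ p, g p.1 * g (ρ • p.1 + √(1 - ρ ^ 2) • p.2)
    ∂((stdGaussianMatrix n d).prod (stdGaussianMatrix n d))

/-- The density of the standard bivariate normal distribution with correlation `c`. -/
def bivariateNormalPDF (c x y : ℝ) : ℝ :=
  1 / (2 * Real.pi * √(1 - c ^ 2)) *
    Real.exp (-(x ^ 2 - 2 * c * x * y + y ^ 2) / (2 * (1 - c ^ 2)))

/-- The joint distribution function of the standard bivariate normal distribution with
correlation `c`. -/
def bivariateNormalCDF (c x y : ℝ) : ℝ :=
  ∫ u in Set.Iic x, ∫ v in Set.Iic y, bivariateNormalPDF c u v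

/-- `s(ρ) = n ∫∫ Φ_{ρ²}(x, y)^{n-1} f_{ρ²}(x, y) dx dy`. -/
def patternStability (n : ℕ) (ρ : ℝ) : ℝ :=
  n * ∫ x, ∫ y, bivariateNormalCDF (ρ ^ 2) x y ^ (n - 1) * bivariateNormalPDF (ρ ^ 2) x y

end

/-! ### Gaussian vectors and matrices: characteristic functions and low moments. -/

noncomputable section

/-! Fix the data. Each score is then linear in the Gaussian matrix `W`, so the scores of all copies
of the data are jointly Gaussian, and the covariance of two of them is a product of two inner
products of rows (`integral_cexp_scores`). Divided by `d`, these inner products concentrate: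
distinct rows become orthogonal, and equal rows of `X` and `Y` have limiting inner product `ρ`
(`gramTendsto_replicas`). Hence the scores divided by `d` converge in law to `n` independent pairs,
each bivariate normal with correlation `ρ ^ 2`. The gaps between unnormalized scores are of order
`d`, so the softmax turns into an argmax, and the probability that the argmaxes for `X` and `Y`
coincide tends to the integral defining `s(ρ)` (`pairPatternProb_const`).

For the stability, expand `f(X) f(Y)` over the pairs of selected tokens. Given the data, the mean
over `W` of the weight of a pair tends to a constant (`exists_forall_abs_selMean_sub_le`), so it
decouples from the product of the two token values. That product has expectation `ρ * (w ⬝ᵥ w)` if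
the tokens agree and `0` otherwise. The decoupling error is controlled in `L²`, which suffices
because the value products have second moments bounded uniformly in `d` and in `w` of bounded norm
(`eventually_abs_integral_mul_selMean_sub_le`).

For given `W`, the `r`-th power of the conditional stability is an expectation over `r` independent
replicas of `(X, Z)` sharing the same `W`. Rows of different replicas are asymptotically orthogonal,
so the limiting patterns of the replicas are independent and the moments tend to powers of one
number (`eventually_abs_integral_attnStability_pow_sub_le`). The cases `r = 1, 2` and Chebyshev's
inequality give convergence in probability.

`IsSelector` treats softmax weights, needed for expectations, and indicators of argmax events,
needed for probabilities, by the same argument. -/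

instance instBorelSpaceRealMatrix {m k : ℕ} : BorelSpace (Matrix (Fin m) (Fin k) ℝ) :=
  inferInstanceAs (BorelSpace (Fin m → Fin k → ℝ))

instance instSecondCountableTopologyRealMatrix {m k : ℕ} :
    SecondCountableTopology (Matrix (Fin m) (Fin k) ℝ) :=
  inferInstanceAs (SecondCountableTopology (Fin m → Fin k → ℝ))

/-- The standard Gaussian measure on `Fin d → ℝ`. -/
def gaussVec (d : ℕ) : Measure (Fin d → ℝ) := Measure.pi fun _ => gaussianReal 0 1

instance (d : ℕ) : IsProbabilityMeasure (gaussVec d) := by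
  unfold gaussVec; infer_instance

instance (n d : ℕ) : IsProbabilityMeasure (stdGaussianMatrix n d) :=
  inferInstanceAs (IsProbabilityMeasure (Measure.pi fun _ : Fin n => gaussVec d))

lemma stdGaussianMatrix_eq (n d : ℕ) :
    stdGaussianMatrix n d = Measure.pi fun _ : Fin n => gaussVec d := rfl

lemma integral_cexp_gaussianReal (t : ℝ) :
    ∫ x, Complex.exp ((t * x : ℝ) * Complex.I) ∂gaussianReal 0 1 =
      Complex.exp (-(t ^ 2 : ℝ) / 2) := by
  have h := charFun_gaussianReal (μ := 0) (v := 1) t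
  rw [charFun_apply_real] at h
  simpa [neg_div] using h

lemma integral_cexp_pi_gaussianReal {ι : Type*} [Fintype ι] (c : ι → ℝ) :
    ∫ ξ, Complex.exp ((∑ a, c a * ξ a : ℝ) * Complex.I)
      ∂(Measure.pi fun _ : ι => gaussianReal 0 1) =
      Complex.exp (-(∑ a, c a ^ 2 : ℝ) / 2) := by
  have h1 : ∀ ξ : ι → ℝ, Complex.exp ((∑ a, c a * ξ a : ℝ) * Complex.I) =
      ∏ a, Complex.exp ((c a * ξ a : ℝ) * Complex.I) := by
    intro ξ
    rw [← Complex.exp_sum]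
    push_cast
    rw [Finset.sum_mul]
  simp_rw [h1]
  rw [integral_fintype_prod_eq_prod
    (f := fun a x => Complex.exp ((c a * x : ℝ) * Complex.I))]
  simp_rw [integral_cexp_gaussianReal]
  rw [← Complex.exp_sum]
  push_cast
  rw [← Finset.sum_div, ← Finset.sum_neg_distrib]

lemma integral_cexp_stdGaussianMatrix {m d : ℕ} (c : Fin m → Fin d → ℝ) :
    ∫ W, Complex.exp ((∑ a, ∑ b, c a b * W a b : ℝ) * Complex.I) ∂stdGaussianMatrix m d =
      Complex.exp (-(∑ a, ∑ b, c a b ^ 2 : ℝ) / 2) := by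
  have h1 : ∀ W : Matrix (Fin m) (Fin d) ℝ,
      Complex.exp ((∑ a, ∑ b, c a b * W a b : ℝ) * Complex.I) =
      ∏ a, Complex.exp ((∑ b, c a b * W a b : ℝ) * Complex.I) := by
    intro W
    rw [← Complex.exp_sum]
    push_cast
    rw [Finset.sum_mul]
  simp_rw [h1]
  rw [stdGaussianMatrix_eq]
  refine (integral_fintype_prod_eq_prod
    (f := fun a (x : Fin d → ℝ) => Complex.exp ((∑ b, c a b * x b : ℝ) * Complex.I))).trans ?_
  simp_rw [gaussVec, integral_cexp_pi_gaussianReal]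
  rw [← Complex.exp_sum]
  push_cast
  rw [← Finset.sum_div, ← Finset.sum_neg_distrib]

lemma measurable_dotProduct_left {d : ℕ} (w : Fin d → ℝ) :
    Measurable fun v : Fin d → ℝ => v ⬝ᵥ w := by
  unfold dotProduct; fun_prop

/-- Both laws have the same characteristic function. Writing the law as a scaled standard Gaussian
reduces every moment of a linear form to a one-dimensional one and includes `w = 0` without a case
distinction. -/
lemma hasLaw_dotProduct {d : ℕ} (w : Fin d → ℝ) :
    HasLaw (fun v : Fin d → ℝ => v ⬝ᵥ w)
      ((gaussianReal 0 1).map fun x => √(w ⬝ᵥ w) * x) (gaussVec d) where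
  aemeasurable := (measurable_dotProduct_left w).aemeasurable
  map_eq := by
    have hm := measurable_dotProduct_left w
    have : IsProbabilityMeasure ((gaussVec d).map fun v : Fin d → ℝ => v ⬝ᵥ w) :=
      Measure.isProbabilityMeasure_map hm.aemeasurable
    have : IsProbabilityMeasure ((gaussianReal 0 1).map fun x => √(w ⬝ᵥ w) * x) :=
      Measure.isProbabilityMeasure_map (by fun_prop)
    apply Measure.ext_of_charFun
    ext t
    rw [charFun_apply_real, charFun_apply_real, integral_map hm.aemeasurable (by fun_prop),
      integral_map (by fun_prop) (by fun_prop)]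
    have h1 : ∀ v : Fin d → ℝ, ((t : ℂ) * ((v ⬝ᵥ w : ℝ) : ℂ)) = ((∑ a, (t * w a) * v a : ℝ) : ℂ) := by
      intro v
      rw [dotProduct, ← Complex.ofReal_mul, Finset.mul_sum]
      congr 1
      exact Finset.sum_congr rfl fun a _ => by ring
    simp_rw [h1]
    rw [gaussVec, integral_cexp_pi_gaussianReal]
    have h2 : ∀ x : ℝ, ((t : ℂ) * ((√(w ⬝ᵥ w) * x : ℝ) : ℂ)) = (((t * √(w ⬝ᵥ w)) * x : ℝ) : ℂ) := by
      intro x; push_cast; ring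
    simp_rw [h2]
    rw [integral_cexp_gaussianReal, mul_pow, Real.sq_sqrt
      (by simpa using dotProduct_star_self_nonneg w), dotProduct, Finset.mul_sum]
    congr 4
    exact Finset.sum_congr rfl fun a _ => by ring

lemma integrable_pow_gaussianReal (p : ℕ) : Integrable (fun x : ℝ => x ^ p) (gaussianReal 0 1) := by
  rcases Nat.eq_zero_or_pos p with rfl | hp
  · simp
  · have h := (memLp_id_gaussianReal (μ := 0) (v := 1) p).integrable_norm_pow hp.ne'
    refine (integrable_norm_iff (by fun_prop)).1 ?_
    simpa [norm_pow] using h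

lemma integral_sq_gaussianReal : ∫ x : ℝ, x ^ 2 ∂gaussianReal 0 1 = 1 := by
  have h := variance_fun_id_gaussianReal (μ := 0) (v := 1)
  rw [variance_of_integral_eq_zero (by fun_prop) (by simp)] at h
  simpa using h

/-- The fourth moment of the standard Gaussian. -/
def gaussFourth : ℝ := ∫ x : ℝ, x ^ 4 ∂gaussianReal 0 1

lemma integrable_dotProduct_pow {d : ℕ} (w : Fin d → ℝ) (p : ℕ) :
    Integrable (fun v : Fin d → ℝ => (v ⬝ᵥ w) ^ p) (gaussVec d) := by
  have h := hasLaw_dotProduct w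
  have : Integrable (fun x : ℝ => x ^ p) ((gaussVec d).map fun v : Fin d → ℝ => v ⬝ᵥ w) := by
    rw [h.map_eq, integrable_map_measure (by fun_prop) (by fun_prop)]
    simp only [Function.comp_def, mul_pow]
    exact (integrable_pow_gaussianReal p).const_mul _
  exact this.comp_aemeasurable h.aemeasurable

lemma integral_dotProduct_pow {d : ℕ} (w : Fin d → ℝ) (p : ℕ) :
    ∫ v, (v ⬝ᵥ w) ^ p ∂gaussVec d = √(w ⬝ᵥ w) ^ p * ∫ x : ℝ, x ^ p ∂gaussianReal 0 1 := by
  refine ((hasLaw_dotProduct w).integral_comp (f := fun x : ℝ => x ^ p) (by fun_prop)).trans ?_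
  rw [integral_map (by fun_prop) (by fun_prop)]
  simp only [mul_pow]
  rw [integral_const_mul]

lemma dotProduct_self_nonneg' {d : ℕ} (w : Fin d → ℝ) : 0 ≤ w ⬝ᵥ w := by
  simpa using dotProduct_star_self_nonneg w

lemma integral_dotProduct {d : ℕ} (w : Fin d → ℝ) : ∫ v, v ⬝ᵥ w ∂gaussVec d = 0 := by
  simpa using integral_dotProduct_pow w 1

lemma integral_dotProduct_sq {d : ℕ} (w : Fin d → ℝ) :
    ∫ v, (v ⬝ᵥ w) ^ 2 ∂gaussVec d = w ⬝ᵥ w := by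
  rw [integral_dotProduct_pow, integral_sq_gaussianReal, Real.sq_sqrt (dotProduct_self_nonneg' w),
    mul_one]

lemma integral_dotProduct_fourth {d : ℕ} (w : Fin d → ℝ) :
    ∫ v, (v ⬝ᵥ w) ^ 4 ∂gaussVec d = (w ⬝ᵥ w) ^ 2 * gaussFourth := by
  rw [integral_dotProduct_pow, gaussFourth]
  congr 1
  rw [show 4 = 2 * 2 from rfl, pow_mul, Real.sq_sqrt (dotProduct_self_nonneg' w)]

/-- The variance of the square of a standard Gaussian. -/
def gaussSqVar : ℝ := Var[fun x : ℝ => x ^ 2; gaussianReal 0 1]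

lemma memLp_sq_gaussianReal : MemLp (fun x : ℝ => x ^ 2) 2 (gaussianReal 0 1) := by
  rw [memLp_two_iff_integrable_sq (by fun_prop)]
  simpa [← pow_mul] using integrable_pow_gaussianReal 4

lemma dotProduct_self_eq_sum {d : ℕ} :
    (fun v : Fin d → ℝ => v ⬝ᵥ v) = ∑ a, fun v : Fin d → ℝ => v a ^ 2 := by
  ext v
  simp [dotProduct, sq]

lemma memLp_dotProduct_self (d : ℕ) : MemLp (fun v : Fin d → ℝ => v ⬝ᵥ v) 2 (gaussVec d) := by
  rw [dotProduct_self_eq_sum]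
  exact memLp_finsetSum' _ fun a _ =>
    memLp_sq_gaussianReal.comp_measurePreserving (measurePreserving_eval _ a)

lemma integral_dotProduct_self (d : ℕ) : ∫ v, v ⬝ᵥ v ∂gaussVec d = d := by
  have : ∀ v : Fin d → ℝ, v ⬝ᵥ v = ∑ a, v a ^ 2 := fun v => by simp [dotProduct, sq]
  simp_rw [this]
  rw [integral_finsetSum]
  · have : ∀ a : Fin d, ∫ v, v a ^ 2 ∂gaussVec d = 1 := fun a =>
      (integral_comp_eval (μ := fun _ : Fin d => gaussianReal 0 1) (i := a)
        (f := fun x : ℝ => x ^ 2) (by fun_prop)).trans integral_sq_gaussianReal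
    simp [this]
  · intro a _
    exact integrable_comp_eval (μ := fun _ : Fin d => gaussianReal 0 1) (f := fun x : ℝ => x ^ 2)
      (integrable_pow_gaussianReal 2)

lemma integral_dotProduct_self_sub_sq (d : ℕ) :
    ∫ v, (v ⬝ᵥ v - d) ^ 2 ∂gaussVec d = d * gaussSqVar := by
  have h := variance_sum_pi (μ := fun _ : Fin d => gaussianReal 0 1)
    (X := fun _ x => x ^ 2) (fun _ => memLp_sq_gaussianReal)
  change Var[∑ a, fun v : Fin d → ℝ => v a ^ 2; gaussVec d] = _ at h
  rw [← dotProduct_self_eq_sum, variance_eq_integral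
    (memLp_dotProduct_self d).aestronglyMeasurable.aemeasurable, integral_dotProduct_self] at h
  rw [h]
  simp [gaussSqVar]

lemma integrable_prod_dotProduct_sq (d : ℕ) :
    Integrable (fun p : (Fin d → ℝ) × (Fin d → ℝ) => (p.1 ⬝ᵥ p.2) ^ 2)
      ((gaussVec d).prod (gaussVec d)) := by
  have hm : Continuous fun p : (Fin d → ℝ) × (Fin d → ℝ) => (p.1 ⬝ᵥ p.2) ^ 2 := by
    unfold dotProduct; fun_prop
  rw [integrable_prod_iff' hm.aestronglyMeasurable]
  refine ⟨.of_forall fun w => integrable_dotProduct_pow w 2, ?_⟩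
  simp only [norm_pow, Real.norm_eq_abs, sq_abs, integral_dotProduct_sq]
  exact (memLp_dotProduct_self d).integrable (by norm_num)

lemma integral_prod_dotProduct_sq (d : ℕ) :
    ∫ p : (Fin d → ℝ) × (Fin d → ℝ), (p.1 ⬝ᵥ p.2) ^ 2 ∂((gaussVec d).prod (gaussVec d)) = d := by
  rw [integral_prod_symm _ (integrable_prod_dotProduct_sq d)]
  simp only [integral_dotProduct_sq]
  exact integral_dotProduct_self d

end

/-! ### Convergence in law of the normalized scores when the Gram matrix converges. -/

noncomputable section

/-- The characteristic function criterion and the portmanteau theorem on `ι → ℝ`. -/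
lemma le_liminf_measure_of_tendsto_integral_cexp {ι : Type*} [Fintype ι]
    {μ : Measure (ι → ℝ)} {ν : ℕ → Measure (ι → ℝ)} [IsProbabilityMeasure μ]
    [∀ m, IsProbabilityMeasure (ν m)]
    (h : ∀ t : ι → ℝ, Tendsto
      (fun m => ∫ x, Complex.exp ((∑ a, t a * x a : ℝ) * Complex.I) ∂ν m) atTop
      (𝓝 (∫ x, Complex.exp ((∑ a, t a * x a : ℝ) * Complex.I) ∂μ)))
    {O : Set (ι → ℝ)} (hO : IsOpen O) :
    μ O ≤ atTop.liminf fun m => ν m O := by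
  -- `charFun` refers to an inner product, so the measures are transported to `EuclideanSpace ℝ ι`
  -- and the open set is pulled back.
  have hm : Measurable (WithLp.toLp 2 : (ι → ℝ) → EuclideanSpace ℝ ι) := by fun_prop
  have hm' : Continuous (WithLp.ofLp : EuclideanSpace ℝ ι → (ι → ℝ)) := by fun_prop
  have key : ∀ (π : Measure (ι → ℝ)) (t : EuclideanSpace ℝ ι),
      charFun (π.map (WithLp.toLp 2 : (ι → ℝ) → EuclideanSpace ℝ ι)) t =
        ∫ x, Complex.exp ((∑ a, t a * x a : ℝ) * Complex.I) ∂π := by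
    intro π t
    rw [charFun_apply, integral_map hm.aemeasurable (by fun_prop)]
    simp [PiLp.inner_apply]
  let μ' : ProbabilityMeasure (EuclideanSpace ℝ ι) :=
    ⟨μ.map (WithLp.toLp 2), Measure.isProbabilityMeasure_map hm.aemeasurable⟩
  let ν' : ℕ → ProbabilityMeasure (EuclideanSpace ℝ ι) := fun m =>
    ⟨(ν m).map (WithLp.toLp 2), Measure.isProbabilityMeasure_map hm.aemeasurable⟩
  have hlim : Tendsto ν' atTop (𝓝 μ') := by
    refine ProbabilityMeasure.tendsto_of_tendsto_charFun fun t => ?_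
    simp only [μ', ν', ProbabilityMeasure.coe_mk, key]
    exact h t
  have hO' := hO.preimage hm'
  have := ProbabilityMeasure.le_liminf_measure_open_of_tendsto hlim hO'
  simpa only [μ', ν', ProbabilityMeasure.coe_mk, Measure.map_apply hm hO'.measurableSet,
    ← Set.preimage_comp, Function.comp_def, Set.preimage_id'] using this

/-- The score matrix `X W Xᵀ`. -/
def scoreMatrix {n d : ℕ} (W : Matrix (Fin d) (Fin d) ℝ) (X : Matrix (Fin n) (Fin d) ℝ) :
    Matrix (Fin n) (Fin n) ℝ :=
  X * W * Xᵀ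

lemma scoreMatrix_apply {n d : ℕ} (W : Matrix (Fin d) (Fin d) ℝ) (X : Matrix (Fin n) (Fin d) ℝ)
    (i k : Fin n) : scoreMatrix W X i k = ∑ a, ∑ b, X i a * X k b * W a b := by
  simp only [scoreMatrix, Matrix.mul_apply, Matrix.transpose_apply, Finset.sum_mul]
  rw [Finset.sum_comm]
  exact Finset.sum_congr rfl fun a _ => Finset.sum_congr rfl fun b _ => by ring

lemma continuous_scoreMatrix {n d : ℕ} : Continuous fun p :
    Matrix (Fin d) (Fin d) ℝ × Matrix (Fin n) (Fin d) ℝ => scoreMatrix p.1 p.2 := by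
  unfold scoreMatrix; fun_prop

variable {n : ℕ} {J : Type*} [Fintype J]

/-- The squared deviation of the normalized Gram matrix of all rows of the matrices `A β` from
the matrix with entries `C β β'` for equal and `0` for different row indices. -/
def gramDev {d : ℕ} (C : J → J → ℝ) (A : J → Matrix (Fin n) (Fin d) ℝ) : ℝ :=
  ∑ a : J × Fin n, ∑ b : J × Fin n,
    ((A a.1 a.2 ⬝ᵥ A b.1 b.2) / d - if a.2 = b.2 then C a.1 b.1 else 0) ^ 2

lemma gramDev_nonneg {d : ℕ} (C : J → J → ℝ) (A : J → Matrix (Fin n) (Fin d) ℝ) :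
    0 ≤ gramDev C A :=
  Finset.sum_nonneg fun _ _ => Finset.sum_nonneg fun _ _ => sq_nonneg _

lemma sq_le_gramDev {d : ℕ} (C : J → J → ℝ) (A : J → Matrix (Fin n) (Fin d) ℝ)
    (a b : J × Fin n) :
    ((A a.1 a.2 ⬝ᵥ A b.1 b.2) / d - if a.2 = b.2 then C a.1 b.1 else 0) ^ 2 ≤ gramDev C A :=
  (Finset.single_le_sum (f := fun b : J × Fin n =>
      ((A a.1 a.2 ⬝ᵥ A b.1 b.2) / d - if a.2 = b.2 then C a.1 b.1 else 0) ^ 2)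
    (fun _ _ => sq_nonneg _) (Finset.mem_univ b)).trans
  (Finset.single_le_sum (f := fun a : J × Fin n => ∑ b : J × Fin n,
      ((A a.1 a.2 ⬝ᵥ A b.1 b.2) / d - if a.2 = b.2 then C a.1 b.1 else 0) ^ 2)
    (fun _ _ => Finset.sum_nonneg fun _ _ => sq_nonneg _) (Finset.mem_univ a))

/-- `g` is distributed as the limit of the normalized score rows: a centred Gaussian family whose
covariance is `C β β' ^ 2` between equal and `0` between different row indices, and each row has
a unique maximum almost surely. -/
structure IsScoreLimit {Ξ : Type*} [MeasurableSpace Ξ] (C : J → J → ℝ) (μ : Measure Ξ)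
    (g : Ξ → J → Fin n → ℝ) : Prop where
  measurable : Measurable g
  integral_cexp : ∀ t : J × Fin n → ℝ,
    ∫ ξ, Complex.exp ((∑ a, t a * g ξ a.1 a.2 : ℝ) * Complex.I) ∂μ =
      Complex.exp (-(∑ a : J × Fin n, ∑ b : J × Fin n,
        t a * t b * (C a.1 b.1 * if a.2 = b.2 then C a.1 b.1 else 0) : ℝ) / 2)
  ae_exists_isArgmax : ∀ᵐ ξ ∂μ, ∀ β, ∃ k, IsArgmax (g ξ β) k

/-- For fixed data the combination of scores is a linear form in `W`, so its variance is the squared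
Frobenius norm of the coefficient matrix. That matrix is a sum of rank-one matrices, and the inner
product of two of these is the product of the inner products of their factors. -/
lemma integral_cexp_scores {d : ℕ} (A : J → Matrix (Fin n) (Fin d) ℝ) (i : Fin n)
    (t : J × Fin n → ℝ) :
    ∫ W, Complex.exp ((∑ a, t a * (scoreMatrix W (A a.1) i a.2 / d) : ℝ) * Complex.I)
      ∂stdGaussianMatrix d d =
      Complex.exp (-(∑ a : J × Fin n, ∑ b : J × Fin n,
        t a * t b * ((A a.1 i ⬝ᵥ A b.1 i) / d * ((A a.1 a.2 ⬝ᵥ A b.1 b.2) / d)) : ℝ) / 2) := by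
  have h1 : ∀ W : Matrix (Fin d) (Fin d) ℝ, ∑ a, t a * (scoreMatrix W (A a.1) i a.2 / d) =
      ∑ p, ∑ q, (∑ a : J × Fin n, t a * (A a.1 i p * A a.1 a.2 q / d)) * W p q := by
    intro W
    simp only [scoreMatrix_apply, Finset.sum_div, Finset.mul_sum, Finset.sum_mul]
    rw [Finset.sum_comm]
    refine Finset.sum_congr rfl fun p _ => ?_
    rw [Finset.sum_comm]
    exact Finset.sum_congr rfl fun q _ => Finset.sum_congr rfl fun a _ => by ring
  simp_rw [h1]
  rw [integral_cexp_stdGaussianMatrix]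
  congr 4
  have h2 : ∀ F : Fin d → Fin d → J × Fin n → J × Fin n → ℝ,
      ∑ p, ∑ q, ∑ a, ∑ b, F p q a b = ∑ a, ∑ b, ∑ p, ∑ q, F p q a b := by
    intro F
    calc ∑ p, ∑ q, ∑ a, ∑ b, F p q a b = ∑ p, ∑ a, ∑ q, ∑ b, F p q a b :=
          Finset.sum_congr rfl fun p _ => Finset.sum_comm
      _ = ∑ a, ∑ p, ∑ q, ∑ b, F p q a b := Finset.sum_comm
      _ = ∑ a, ∑ p, ∑ b, ∑ q, F p q a b :=
          Finset.sum_congr rfl fun a _ => Finset.sum_congr rfl fun p _ => Finset.sum_comm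
      _ = ∑ a, ∑ b, ∑ p, ∑ q, F p q a b := Finset.sum_congr rfl fun a _ => Finset.sum_comm
  have h3 : ∀ p q, (∑ a : J × Fin n, t a * (A a.1 i p * A a.1 a.2 q / d)) ^ 2 =
      ∑ a : J × Fin n, ∑ b : J × Fin n, (t a * (A a.1 i p * A a.1 a.2 q / d)) *
        (t b * (A b.1 i p * A b.1 b.2 q / d)) := fun p q => by
    rw [sq]; exact Finset.sum_mul_sum _ _ _ _
  refine (Finset.sum_congr rfl fun p _ => Finset.sum_congr rfl fun q _ => h3 p q).trans
    ((h2 _).trans ?_)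
  refine Finset.sum_congr rfl fun a _ => Finset.sum_congr rfl fun b _ => ?_
  have h4 : (A a.1 i ⬝ᵥ A b.1 i) / d * ((A a.1 a.2 ⬝ᵥ A b.1 b.2) / d) =
      ∑ p, ∑ q, (A a.1 i p * A b.1 i p / d) * (A a.1 a.2 q * A b.1 b.2 q / d) := by
    rw [dotProduct, dotProduct, Finset.sum_div, Finset.sum_div]
    exact Finset.sum_mul_sum _ _ _ _
  rw [h4, Finset.mul_sum]
  refine Finset.sum_congr rfl fun p _ => ?_
  rw [Finset.mul_sum]
  exact Finset.sum_congr rfl fun q _ => by ring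

lemma measurable_normalized_scores {d : ℕ} (A : J → Matrix (Fin n) (Fin d) ℝ) (i : Fin n) :
    Measurable fun (W : Matrix (Fin d) (Fin d) ℝ) (a : J × Fin n) =>
      scoreMatrix W (A a.1) i a.2 / d := by
  refine Continuous.measurable (continuous_pi fun a => ?_)
  have : Continuous fun W : Matrix (Fin d) (Fin d) ℝ => scoreMatrix W (A a.1) := by
    unfold scoreMatrix; fun_prop
  exact (continuous_apply_apply i a.2 |>.comp this).div_const _

/-- If the Gram matrix is close to its limit, the law of the normalized scores gives every open
set at least almost the limiting probability. -/
lemma exists_forall_gramDev_lt_measure_open {Ξ : Type*} [MeasurableSpace Ξ] {C : J → J → ℝ}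
    {μ : Measure Ξ} [IsProbabilityMeasure μ] {g : Ξ → J → Fin n → ℝ} (hg : IsScoreLimit C μ g)
    (i : Fin n) {O : Set (J × Fin n → ℝ)} (hO : IsOpen O) {η : ℝ} (hη : 0 < η) :
    ∃ θ > 0, ∀ (d : ℕ) (A : J → Matrix (Fin n) (Fin d) ℝ), gramDev C A < θ →
      μ.real {ξ | (fun a : J × Fin n => g ξ a.1 a.2) ∈ O} - η ≤
        (stdGaussianMatrix d d).real
          {W | (fun a : J × Fin n => scoreMatrix W (A a.1) i a.2 / d) ∈ O} := by
  -- A failure for every `θ` yields data with `gramDev` tending to `0` that violate the portmanteau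
  -- inequality. The dimensions `d m` need not grow: the law of the normalized scores depends on the
  -- Gram matrix only.
  by_contra! hcon
  choose d A hA hlt using fun m : ℕ => hcon (1 / ((m : ℝ) + 1)) (by positivity)
  have hgm : Measurable fun (ξ : Ξ) (a : J × Fin n) => g ξ a.1 a.2 := by
    have := hg.measurable
    fun_prop
  have hsm := fun m => measurable_normalized_scores (A m) i
  have hdev : Tendsto (fun m => gramDev C (A m)) atTop (𝓝 0) :=
    squeeze_zero (fun m => gramDev_nonneg _ _) (fun m => (hA m).le)
      tendsto_one_div_add_atTop_nhds_zero_nat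
  have hgram : ∀ a b : J × Fin n, Tendsto (fun m => (A m a.1 a.2 ⬝ᵥ A m b.1 b.2) / (d m : ℝ))
      atTop (𝓝 (if a.2 = b.2 then C a.1 b.1 else 0)) := by
    intro a b
    rw [tendsto_iff_dist_tendsto_zero]
    have h0 : Tendsto (fun m => √(gramDev C (A m))) atTop (𝓝 0) := by
      simpa [Function.comp_def] using (Real.continuous_sqrt.tendsto 0).comp hdev
    refine squeeze_zero (fun _ => dist_nonneg) (fun m => ?_) h0
    rw [Real.dist_eq]
    exact Real.abs_le_sqrt (sq_le_gramDev C (A m) a b)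
  have : IsProbabilityMeasure (μ.map fun (ξ : Ξ) (a : J × Fin n) => g ξ a.1 a.2) :=
    Measure.isProbabilityMeasure_map hgm.aemeasurable
  have : ∀ m, IsProbabilityMeasure ((stdGaussianMatrix (d m) (d m)).map
      fun (W : Matrix (Fin (d m)) (Fin (d m)) ℝ) (a : J × Fin n) =>
        scoreMatrix W (A m a.1) i a.2 / d m) :=
    fun m => Measure.isProbabilityMeasure_map (hsm m).aemeasurable
  have key := le_liminf_measure_of_tendsto_integral_cexp
    (μ := μ.map fun (ξ : Ξ) (a : J × Fin n) => g ξ a.1 a.2)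
    (ν := fun m => (stdGaussianMatrix (d m) (d m)).map
      fun (W : Matrix (Fin (d m)) (Fin (d m)) ℝ) (a : J × Fin n) =>
        scoreMatrix W (A m a.1) i a.2 / d m) (fun t => ?_) hO
  · simp only [Measure.map_apply (hsm _) hO.measurableSet,
      Measure.map_apply hgm hO.measurableSet] at key
    have hle : atTop.liminf (fun m => stdGaussianMatrix (d m) (d m)
        ((fun (W : Matrix (Fin (d m)) (Fin (d m)) ℝ) (a : J × Fin n) =>
          scoreMatrix W (A m a.1) i a.2 / d m) ⁻¹' O)) ≤
        ENNReal.ofReal (μ.real {ξ | (fun a : J × Fin n => g ξ a.1 a.2) ∈ O} - η) := by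
      refine (liminf_le_liminf (v := fun _ => ENNReal.ofReal
        (μ.real {ξ | (fun a : J × Fin n => g ξ a.1 a.2) ∈ O} - η))
        (.of_forall fun m => ?_)).trans (by simp)
      refine (ENNReal.le_ofReal_iff_toReal_le (measure_ne_top _ _) ?_).2 (hlt m).le
      exact measureReal_nonneg.trans (hlt m).le
    have h2 := key.trans hle
    have h3 := (ENNReal.le_ofReal_iff_toReal_le (measure_ne_top _ _)
      (measureReal_nonneg.trans (hlt 0).le)).1 h2
    have h4 : μ.real {ξ | (fun a : J × Fin n => g ξ a.1 a.2) ∈ O} ≤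
      μ.real {ξ | (fun a : J × Fin n => g ξ a.1 a.2) ∈ O} - η := h3
    linarith
  · have hc : Continuous fun x : J × Fin n → ℝ =>
      Complex.exp ((∑ a, t a * x a : ℝ) * Complex.I) := by fun_prop
    rw [integral_map hgm.aemeasurable hc.aestronglyMeasurable, hg.integral_cexp]
    refine Tendsto.congr (fun m => ((integral_map (hsm m).aemeasurable
      hc.aestronglyMeasurable).trans (integral_cexp_scores (A m) i t)).symm) ?_
    refine (Complex.continuous_exp.tendsto _).comp (Tendsto.div_const (Tendsto.neg ?_) _)
    refine (Complex.continuous_ofReal.tendsto _).comp ?_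
    refine tendsto_finsetSum _ fun a _ => tendsto_finsetSum _ fun b _ => Tendsto.const_mul _ ?_
    -- The row `i`, common to all the scores, contributes the factor `C a.1 b.1`; the other rows
    -- contribute the factor that vanishes for different indices.
    have := hgram (a.1, i) (b.1, i)
    simp only [if_true] at this
    exact this.mul (hgram a b)

end

/-! ### Selectors, and their mean over `W` for fixed data. -/

noncomputable section

variable {n : ℕ} {J : Type*} [Fintype J]

/-- A family of weights on the patterns `κ`, as functions of the score rows, that puts almost all
weight on the pattern of maxima when all gaps are large. -/
structure IsSelector (F : (J → Fin n) → (J → Fin n → ℝ) → ℝ) : Prop where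
  measurable : ∀ κ, Measurable (F κ)
  nonneg : ∀ κ v, 0 ≤ F κ v
  sum_le_one : ∀ (s : Finset (J → Fin n)) v, ∑ κ ∈ s, F κ v ≤ 1
  near_one : ∀ ε > 0, ∃ H : ℝ, ∀ κ v, (∀ β j, j ≠ κ β → v β j + H < v β (κ β)) → 1 - ε ≤ F κ v

/-- The probability of the pattern `κ` of maxima. -/
def patternProb {Ξ : Type*} [MeasurableSpace Ξ] (μ : Measure Ξ) (g : Ξ → J → Fin n → ℝ)
    (κ : J → Fin n) : ℝ :=
  μ.real {ξ | ∀ β, IsArgmax (g ξ β) (κ β)}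

/-- The mean weight of the pattern `κ` over a Gaussian `W`. -/
def selMean {d : ℕ} (F : (J → Fin n) → (J → Fin n → ℝ) → ℝ) (A : J → Matrix (Fin n) (Fin d) ℝ)
    (i : Fin n) (κ : J → Fin n) : ℝ :=
  ∫ W, F κ (fun β => scoreMatrix W (A β) i) ∂stdGaussianMatrix d d

lemma IsArgmax.unique {v : Fin n → ℝ} {k l : Fin n} (hk : IsArgmax v k) (hl : IsArgmax v l) :
    k = l := by
  by_contra h
  exact lt_asymm (hl k h) (hk l (Ne.symm h))

lemma measurableSet_setOf_isArgmax (k : Fin n) : MeasurableSet {v : Fin n → ℝ | IsArgmax v k} := by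
  have : {v : Fin n → ℝ | IsArgmax v k} = ⋂ j, ⋂ (_ : j ≠ k), {v | v j < v k} := by
    ext v; simp [IsArgmax]
  rw [this]
  exact MeasurableSet.iInter fun j => MeasurableSet.iInter fun _ =>
    measurableSet_lt (measurable_pi_apply j) (measurable_pi_apply k)

lemma measurableSet_setOf_pattern {Ξ : Type*} [MeasurableSpace Ξ] {g : Ξ → J → Fin n → ℝ}
    (hg : Measurable g) (κ : J → Fin n) :
    MeasurableSet {ξ | ∀ β, IsArgmax (g ξ β) (κ β)} := by
  rw [Set.ofPred_forall]
  exact MeasurableSet.iInter fun β =>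
    (measurable_pi_iff.1 hg β) (measurableSet_setOf_isArgmax (κ β))

lemma sum_patternProb [DecidableEq J] {Ξ : Type*} [MeasurableSpace Ξ] {C : J → J → ℝ}
    {μ : Measure Ξ} [IsProbabilityMeasure μ] {g : Ξ → J → Fin n → ℝ} (hg : IsScoreLimit C μ g) :
    ∑ κ, patternProb μ g κ = 1 := by
  have h := measureReal_biUnion_finset (μ := μ) (s := (Finset.univ : Finset (J → Fin n)))
    (f := fun κ => {ξ | ∀ β, IsArgmax (g ξ β) (κ β)}) ?_
    fun κ _ => measurableSet_setOf_pattern hg.measurable κ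
  · simp only [patternProb]
    rw [← h]
    have : (⋃ κ ∈ (Finset.univ : Finset (J → Fin n)), {ξ | ∀ β, IsArgmax (g ξ β) (κ β)}) =ᵐ[μ]
        Set.univ := by
      rw [eventuallyEq_univ]
      filter_upwards [hg.ae_exists_isArgmax] with ξ hξ
      choose κ hκ using hξ
      simp only [Finset.mem_univ, Set.iUnion_true, Set.mem_iUnion]
      exact ⟨κ, hκ⟩
    rw [measureReal_congr this, probReal_univ]
  · intro κ _ κ' _ hne
    refine Set.disjoint_left.2 fun ξ h1 h2 => hne ?_
    exact funext fun β => (h1 β).unique (h2 β)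

/-- The events with gaps above `1 / (m + 1)` increase to the event of strict maxima, so continuity
of measure from below applies. -/
lemma exists_patternProb_le_gap {Ξ : Type*} [MeasurableSpace Ξ] {μ : Measure Ξ}
    [IsProbabilityMeasure μ] {g : Ξ → J → Fin n → ℝ}
    (κ : J → Fin n) {η : ℝ} (hη : 0 < η) :
    ∃ γ > 0, patternProb μ g κ - η ≤
      μ.real {ξ | ∀ β j, j ≠ κ β → g ξ β j + γ < g ξ β (κ β)} := by
  let S : ℕ → Set Ξ := fun m => {ξ | ∀ β j, j ≠ κ β → g ξ β j + 1 / ((m : ℝ) + 1) < g ξ β (κ β)}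
  have hmono : Monotone S := by
    intro m m' hmm ξ hξ β j hj
    have := hξ β j hj
    have h2 : 1 / ((m' : ℝ) + 1) ≤ 1 / ((m : ℝ) + 1) := one_div_le_one_div_of_le (by positivity)
      (by exact_mod_cast Nat.succ_le_succ hmm)
    linarith
  have hU : (⋃ m, S m) = {ξ | ∀ β, IsArgmax (g ξ β) (κ β)} := by
    ext ξ
    simp only [Set.mem_iUnion, Set.mem_ofPred_eq, S]
    constructor
    · rintro ⟨m, hm⟩ β j hj
      have := hm β j hj
      have h2 : 0 < 1 / ((m : ℝ) + 1) := by positivity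
      linarith
    · intro h
      have hev : ∀ᶠ m : ℕ in atTop, ∀ p : J × Fin n, p.2 ≠ κ p.1 →
          g ξ p.1 p.2 + 1 / ((m : ℝ) + 1) < g ξ p.1 (κ p.1) := by
        rw [eventually_all]
        intro p
        by_cases hp : p.2 = κ p.1
        · exact .of_forall fun _ h => absurd hp h
        · have hlim : Tendsto (fun m : ℕ => g ξ p.1 p.2 + 1 / ((m : ℝ) + 1)) atTop
              (𝓝 (g ξ p.1 p.2 + 0)) := tendsto_one_div_add_atTop_nhds_zero_nat.const_add _
          rw [add_zero] at hlim
          exact (hlim.eventually_lt_const (h p.1 p.2 hp)).mono fun _ h _ => h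
      obtain ⟨m, hm⟩ := hev.exists
      exact ⟨m, fun β j hj => hm (β, j) hj⟩
  have hlim := tendsto_measure_iUnion_atTop (μ := μ) hmono
  rw [hU] at hlim
  have hlim' : Tendsto (fun m => μ.real (S m)) atTop (𝓝 (patternProb μ g κ)) :=
    (ENNReal.tendsto_toReal (measure_ne_top _ _)).comp hlim
  obtain ⟨m, hm⟩ := (hlim'.eventually_const_lt (sub_lt_self _ hη)).exists
  exact ⟨1 / ((m : ℝ) + 1), by positivity, hm.le⟩

lemma IsSelector.le_one {J : Type*} {F : (J → Fin n) → (J → Fin n → ℝ) → ℝ} (hF : IsSelector F) (κ v) :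
    F κ v ≤ 1 := by
  simpa using hF.sum_le_one {κ} v

lemma measurable_scores_row {d : ℕ} (A : J → Matrix (Fin n) (Fin d) ℝ) (i : Fin n) :
    Measurable fun (W : Matrix (Fin d) (Fin d) ℝ) (β : J) => scoreMatrix W (A β) i := by
  refine Continuous.measurable (continuous_pi fun β => ?_)
  have : Continuous fun W : Matrix (Fin d) (Fin d) ℝ => scoreMatrix W (A β) := by
    unfold scoreMatrix; fun_prop
  exact (continuous_apply i).comp this

lemma IsSelector.integrable {F : (J → Fin n) → (J → Fin n → ℝ) → ℝ} (hF : IsSelector F) {d : ℕ}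
    (A : J → Matrix (Fin n) (Fin d) ℝ) (i : Fin n) (κ : J → Fin n) :
    Integrable (fun W => F κ (fun β => scoreMatrix W (A β) i)) (stdGaussianMatrix d d) := by
  refine Integrable.of_bound (C := 1)
    ((hF.measurable κ).comp (measurable_scores_row A i)).aestronglyMeasurable
    (.of_forall fun W => ?_)
  rw [Real.norm_eq_abs, abs_of_nonneg (hF.nonneg _ _)]
  exact hF.le_one _ _

lemma selMean_nonneg {J : Type*} {F : (J → Fin n) → (J → Fin n → ℝ) → ℝ} (hF : IsSelector F) {d : ℕ}
    (A : J → Matrix (Fin n) (Fin d) ℝ) (i : Fin n) (κ : J → Fin n) : 0 ≤ selMean F A i κ :=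
  integral_nonneg fun _ => hF.nonneg _ _

lemma selMean_le_one {F : (J → Fin n) → (J → Fin n → ℝ) → ℝ} (hF : IsSelector F) {d : ℕ}
    (A : J → Matrix (Fin n) (Fin d) ℝ) (i : Fin n) (κ : J → Fin n) : selMean F A i κ ≤ 1 := by
  have h := integral_mono (hF.integrable A i κ) (integrable_const (1 : ℝ))
    fun W => hF.le_one κ _
  simpa [selMean] using h

/-- A gap `γ` between normalized scores is a gap `d * γ` between scores, which exceeds the threshold
`H` of the selector once `d` is large. One `η` is lost in passing to positive gaps, one in the
portmanteau inequality and one because the selector is only `1 - η` on the gap event. -/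
lemma exists_forall_le_selMean {Ξ : Type*} [MeasurableSpace Ξ] {C : J → J → ℝ}
    {μ : Measure Ξ} [IsProbabilityMeasure μ] {g : Ξ → J → Fin n → ℝ} (hg : IsScoreLimit C μ g)
    {F : (J → Fin n) → (J → Fin n → ℝ) → ℝ} (hF : IsSelector F) (i : Fin n) (κ : J → Fin n)
    {η : ℝ} (hη : 0 < η) :
    ∃ θ > 0, ∃ d₀ : ℕ, ∀ d ≥ d₀, ∀ A : J → Matrix (Fin n) (Fin d) ℝ, gramDev C A < θ →
      patternProb μ g κ - 3 * η ≤ selMean F A i κ := by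
  obtain ⟨γ, hγ, hγ'⟩ := exists_patternProb_le_gap (μ := μ) (g := g) κ hη
  obtain ⟨H, hH⟩ := hF.near_one η hη
  let O : Set (J × Fin n → ℝ) := {v | ∀ β j, j ≠ κ β → v (β, j) + γ < v (β, κ β)}
  have hO : IsOpen O := by
    have : O = ⋂ β, ⋂ j, ⋂ (_ : j ≠ κ β), {v | v (β, j) + γ < v (β, κ β)} := by
      ext v; simp [O]
    rw [this]
    exact isOpen_iInter_of_finite fun β => isOpen_iInter_of_finite fun j =>
      isOpen_iInter_of_finite fun _ => isOpen_lt (by fun_prop) (by fun_prop)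
  obtain ⟨θ, hθ, hθ'⟩ := exists_forall_gramDev_lt_measure_open hg i hO hη
  obtain ⟨d₀, hd₀⟩ := exists_nat_ge (H / γ)
  refine ⟨θ, hθ, max d₀ 1, fun d hd A hA => ?_⟩
  have h1 := hθ' d A hA
  set E : Set (Matrix (Fin d) (Fin d) ℝ) :=
    {W | (fun a : J × Fin n => scoreMatrix W (A a.1) i a.2 / d) ∈ O} with hE
  have hEm : MeasurableSet E := (measurable_normalized_scores A i) hO.measurableSet
  have hd1 : (0 : ℝ) < d := by exact_mod_cast (le_max_right _ _).trans hd
  have hdH : H ≤ d * γ := by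
    have : H / γ ≤ d := hd₀.trans (by exact_mod_cast (le_max_left _ _).trans hd)
    rwa [div_le_iff₀ hγ] at this
  have hlow : ∀ W, E.indicator (fun _ => 1 - η) W ≤ F κ (fun β => scoreMatrix W (A β) i) := by
    intro W
    by_cases hW : W ∈ E
    · rw [Set.indicator_of_mem hW]
      refine hH κ _ fun β j hj => ?_
      have := hW β j hj
      simp only at this
      rw [div_add' _ _ _ hd1.ne', div_lt_div_iff_of_pos_right hd1] at this
      linarith
    · rw [Set.indicator_of_notMem hW]
      exact hF.nonneg _ _
  have h2 := integral_mono ((integrable_const (1 - η)).indicator hEm) (hF.integrable A i κ) hlow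
  rw [integral_indicator_const _ hEm, smul_eq_mul] at h2
  have h3 : (stdGaussianMatrix d d).real E ≤ 1 := measureReal_le_one
  have h4 : 0 ≤ (stdGaussianMatrix d d).real E := measureReal_nonneg
  have h5 : patternProb μ g κ - η ≤ μ.real {ξ | (fun a : J × Fin n => g ξ a.1 a.2) ∈ O} := hγ'
  change _ ≤ selMean F A i κ at h2
  nlinarith

/-- If the Gram matrix is close to its limit and the dimension is large, then the mean weights are
close to the limiting probabilities of the patterns. -/
lemma exists_forall_abs_selMean_sub_le {Ξ : Type*} [MeasurableSpace Ξ]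
    {C : J → J → ℝ} {μ : Measure Ξ} [IsProbabilityMeasure μ] {g : Ξ → J → Fin n → ℝ}
    (hg : IsScoreLimit C μ g) {F : (J → Fin n) → (J → Fin n → ℝ) → ℝ} (hF : IsSelector F)
    {η : ℝ} (hη : 0 < η) :
    ∃ θ > 0, ∃ d₀ : ℕ, ∀ d ≥ d₀, ∀ A : J → Matrix (Fin n) (Fin d) ℝ, gramDev C A < θ →
      ∀ i κ, |selMean F A i κ - patternProb μ g κ| ≤ η := by
  classical
  set N : ℝ := ((Fintype.card (J → Fin n) : ℕ) : ℝ) with hN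
  rcases isEmpty_or_nonempty (Fin n × (J → Fin n)) with hemp | hne
  · exact ⟨1, one_pos, 0, fun d _ A _ i κ => (hemp.false (i, κ)).elim⟩
  obtain ⟨⟨i₀, κ₀⟩⟩ := hne
  have hNpos : 1 ≤ N := by
    rw [hN]; exact_mod_cast Fintype.card_pos_iff.2 ⟨κ₀⟩
  -- With `N` patterns, each lower bound may lose `η / N`.
  have hη1 : 0 < η / (3 * N) := by positivity
  choose θ hθ d₀ hlow using fun p : Fin n × (J → Fin n) =>
    exists_forall_le_selMean hg hF p.1 p.2 hη1
  have hne : (Finset.univ : Finset (Fin n × (J → Fin n))).Nonempty := ⟨(i₀, κ₀), Finset.mem_univ _⟩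
  refine ⟨Finset.univ.inf' hne θ, (Finset.lt_inf'_iff hne).2 fun p _ => hθ p, Finset.univ.sup d₀,
    fun d hd A hA i => ?_⟩
  have hl : ∀ κ, patternProb μ g κ - 3 * (η / (3 * N)) ≤ selMean F A i κ := fun κ =>
    hlow (i, κ) d ((Finset.le_sup (Finset.mem_univ (i, κ))).trans hd) A
      (hA.trans_le (Finset.inf'_le _ (Finset.mem_univ (i, κ))))
  have h3 : 3 * (η / (3 * N)) = η / N := by field_simp
  rw [h3] at hl
  -- The upper bound comes from the lower bounds for all other patterns: the weights sum to at most
  -- `1` and the limiting probabilities to exactly `1`, so the excess at `κ` is at most the `N - 1`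
  -- losses elsewhere.
  have hsum : ∑ κ, selMean F A i κ ≤ 1 := by
    simp only [selMean]
    rw [← integral_finsetSum _ fun κ _ => hF.integrable A i κ]
    have h := integral_mono (integrable_finsetSum _ fun κ _ => hF.integrable A i κ)
      (integrable_const (1 : ℝ)) (fun W => hF.sum_le_one Finset.univ _)
    simpa using h
  intro κ
  have hηN : η / N ≤ η := div_le_self hη.le hNpos
  rw [abs_le]
  refine ⟨by linarith [hl κ], ?_⟩
  have hp := sum_patternProb hg
  have h5 : ∑ κ' ∈ Finset.univ.erase κ, (patternProb μ g κ' - η / N) ≤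
      ∑ κ' ∈ Finset.univ.erase κ, selMean F A i κ' := Finset.sum_le_sum fun κ' _ => hl κ'
  rw [Finset.sum_sub_distrib, Finset.sum_const, Finset.card_erase_of_mem (Finset.mem_univ _),
    nsmul_eq_mul, Finset.card_univ, Nat.cast_sub (Fintype.card_pos_iff.2 ⟨κ₀⟩), ← hN] at h5
  have h6 := Finset.add_sum_erase Finset.univ (patternProb μ g) (Finset.mem_univ κ)
  have h7 := Finset.add_sum_erase Finset.univ (selMean F A i) (Finset.mem_univ κ)
  have h8 : (N - 1) * (η / N) ≤ η := by
    rw [sub_mul, mul_div_cancel₀ _ (by positivity)]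
    have : 0 ≤ η / N := by positivity
    linarith
  push_cast at h5
  linarith

end

/-! ### Averaging over random data. -/

noncomputable section

variable {n : ℕ} {J : Type*} [Fintype J]

/-- Random matrices `A d` whose normalized Gram matrices converge to `C` in mean square. -/
structure GramTendsto {S : ℕ → Type*} [∀ d, MeasurableSpace (S d)] (m : ∀ d, Measure (S d))
    (C : J → J → ℝ) (A : ∀ d, S d → J → Matrix (Fin n) (Fin d) ℝ) : Prop where
  integrable : ∀ d, Integrable (fun s => gramDev C (A d s)) (m d)
  tendsto : Tendsto (fun d => ∫ s, gramDev C (A d s) ∂m d) atTop (𝓝 0)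

/-- The mean weights converge to the limiting pattern probabilities in `L²`, tested against
weights with bounded second moment. -/
lemma eventually_abs_integral_mul_selMean_sub_le {S : ℕ → Type*} [∀ d, MeasurableSpace (S d)]
    {m : ∀ d, Measure (S d)} [∀ d, IsProbabilityMeasure (m d)] {C : J → J → ℝ}
    {A : ∀ d, S d → J → Matrix (Fin n) (Fin d) ℝ} (hA : GramTendsto m C A)
    {Ξ : Type*} [MeasurableSpace Ξ] {μ : Measure Ξ} [IsProbabilityMeasure μ]
    {g : Ξ → J → Fin n → ℝ} (hg : IsScoreLimit C μ g)
    {F : (J → Fin n) → (J → Fin n → ℝ) → ℝ} (hF : IsSelector F) {M ε : ℝ} (hM : 0 < M)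
    (hε : 0 < ε) :
    ∀ᶠ d in atTop, ∀ Ψ : S d → ℝ, Integrable (fun s => Ψ s ^ 2) (m d) → ∫ s, Ψ s ^ 2 ∂m d ≤ M →
      ∀ i κ, |∫ s, Ψ s * (selMean F (A d s) i κ - patternProb μ g κ) ∂m d| ≤ ε := by
  -- This is the weight in `x * y ≤ lam * x ^ 2 + y ^ 2 / (4 * lam)`. The first term integrates to
  -- at most `lam * M = ε / 2`. The mean of `y ^ 2` is at most `2 * lam * ε`, so the second also
  -- contributes at most `ε / 2`.
  set lam : ℝ := ε / (2 * M) with hlam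
  have hlampos : 0 < lam := by positivity
  have hη : 0 < √(lam * ε) := Real.sqrt_pos.2 (by positivity)
  obtain ⟨θ, hθ, d₀, hd₀⟩ := exists_forall_abs_selMean_sub_le hg hF hη
  have hev : ∀ᶠ d in atTop, ∫ s, gramDev C (A d s) ∂m d < θ * (lam * ε) :=
    hA.tendsto.eventually_lt_const (by positivity)
  filter_upwards [hev, eventually_ge_atTop d₀] with d hd1 hd2 Ψ hΨ hΨM i κ
  -- For a good Gram matrix the difference is at most `√(lam * ε)`. For a bad one it is at most `1`,
  -- and `gramDev / θ ≥ 1` pays for it as in Markov's inequality.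
  have hsq : ∀ s, (selMean F (A d s) i κ - patternProb μ g κ) ^ 2 ≤
      lam * ε + gramDev C (A d s) / θ := by
    intro s
    by_cases hs : gramDev C (A d s) < θ
    · have h1 := sq_le_sq' (abs_le.1 (hd₀ d hd2 _ hs i κ)).1 (abs_le.1 (hd₀ d hd2 _ hs i κ)).2
      rw [Real.sq_sqrt (by positivity)] at h1
      have : 0 ≤ gramDev C (A d s) / θ := div_nonneg (gramDev_nonneg _ _) hθ.le
      linarith
    · have h1 : 1 ≤ gramDev C (A d s) / θ := (one_le_div hθ).2 (not_lt.1 hs)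
      have h2 : |selMean F (A d s) i κ - patternProb μ g κ| ≤ 1 := by
        have h3 := selMean_nonneg hF (A d s) i κ
        have h4 := selMean_le_one hF (A d s) i κ
        have h5 : 0 ≤ patternProb μ g κ := measureReal_nonneg
        have h6 : patternProb μ g κ ≤ 1 := measureReal_le_one
        rw [abs_le]; constructor <;> linarith
      have h3 := (sq_le_one_iff_abs_le_one _).2 h2
      have : 0 < lam * ε := by positivity
      linarith
  have hbound : ∀ s, ‖Ψ s * (selMean F (A d s) i κ - patternProb μ g κ)‖ ≤
      lam * Ψ s ^ 2 + (lam * ε + gramDev C (A d s) / θ) / (4 * lam) := by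
    intro s
    rw [Real.norm_eq_abs, abs_mul]
    set x := |Ψ s|
    set y := |selMean F (A d s) i κ - patternProb μ g κ|
    have hx : Ψ s ^ 2 = x ^ 2 := (sq_abs _).symm
    have hy : y ^ 2 ≤ lam * ε + gramDev C (A d s) / θ := by
      rw [sq_abs]; exact hsq s
    rw [hx]
    have h1 : x * y ≤ lam * x ^ 2 + y ^ 2 / (4 * lam) := by
      have : lam * x ^ 2 + y ^ 2 / (4 * lam) - x * y = (2 * lam * x - y) ^ 2 / (4 * lam) := by
        field_simp; ring
      have h2 : 0 ≤ (2 * lam * x - y) ^ 2 / (4 * lam) := by positivity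
      linarith
    have h2 : y ^ 2 / (4 * lam) ≤ (lam * ε + gramDev C (A d s) / θ) / (4 * lam) := by gcongr
    linarith
  have hi1 : Integrable (fun s => lam * Ψ s ^ 2) (m d) := hΨ.const_mul _
  have hi2 : Integrable (fun s => (lam * ε + gramDev C (A d s) / θ) / (4 * lam)) (m d) :=
    ((integrable_const _).add ((hA.integrable d).div_const θ)).div_const _
  have h := norm_integral_le_of_norm_le (hi1.add hi2) (.of_forall hbound)
  rw [Real.norm_eq_abs] at h
  refine h.trans ?_
  simp only [Pi.add_apply]
  rw [integral_add hi1 hi2, integral_const_mul, integral_div, integral_add (integrable_const _)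
    ((hA.integrable d).div_const θ), integral_div]
  simp only [integral_const, probReal_univ, one_smul]
  have h1 : lam * ∫ s, Ψ s ^ 2 ∂m d ≤ ε / 2 := by
    calc lam * ∫ s, Ψ s ^ 2 ∂m d ≤ lam * M := by gcongr
      _ = ε / 2 := by rw [hlam]; field_simp
  have h2 : (∫ s, gramDev C (A d s) ∂m d) / θ ≤ lam * ε := by
    rw [div_le_iff₀ hθ]; linarith
  have h3 : (lam * ε + (∫ s, gramDev C (A d s) ∂m d) / θ) / (4 * lam) ≤ ε / 2 := by
    rw [div_le_iff₀ (by positivity)]; linarith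
  linarith

end

/-! ### The bivariate normal law: construction, density, absence of ties. -/

noncomputable section

lemma hasLaw_eval_pair {ι E : Type*} [Fintype ι] [MeasurableSpace E] (μ : Measure E)
    [IsProbabilityMeasure μ] {j k : ι} (hjk : j ≠ k) :
    HasLaw (fun e : ι → E => (e j, e k)) (μ.prod μ) (Measure.pi fun _ => μ) where
  aemeasurable := by fun_prop
  map_eq := by
    have h := (iIndepFun_pi (μ := fun _ : ι => μ) (X := fun _ => id)
      fun _ => aemeasurable_id).indepFun hjk
    have h2 := h.map_prod_eq_prod_map_map (measurable_pi_apply j).aemeasurable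
      (measurable_pi_apply k).aemeasurable
    refine h2.trans ?_
    congr 1
    · exact (measurePreserving_eval (fun _ : ι => μ) j).map_eq
    · exact (measurePreserving_eval (fun _ : ι => μ) k).map_eq

/-- The standard bivariate normal law with correlation `c`. -/
def bivariateNormal (c : ℝ) : Measure (ℝ × ℝ) :=
  ((gaussianReal 0 1).prod (gaussianReal 0 1)).map fun p => (p.1, c * p.1 + √(1 - c ^ 2) * p.2)

instance (c : ℝ) : IsProbabilityMeasure (bivariateNormal c) :=
  Measure.isProbabilityMeasure_map (by fun_prop)

lemma integral_cexp_bivariateNormal {c : ℝ} (hc : c ^ 2 ≤ 1) (x y : ℝ) :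
    ∫ p, Complex.exp ((x * p.1 + y * p.2 : ℝ) * Complex.I) ∂bivariateNormal c =
      Complex.exp (-(x ^ 2 + 2 * c * x * y + y ^ 2 : ℝ) / 2) := by
  rw [bivariateNormal, integral_map (by fun_prop) (by fun_prop)]
  have h : ∀ p : ℝ × ℝ, Complex.exp ((x * p.1 + y * (c * p.1 + √(1 - c ^ 2) * p.2) : ℝ) *
      Complex.I) = Complex.exp (((x + y * c) * p.1 : ℝ) * Complex.I) *
        Complex.exp (((y * √(1 - c ^ 2)) * p.2 : ℝ) * Complex.I) := by
    intro p
    rw [← Complex.exp_add, ← add_mul]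
    congr 2
    push_cast
    ring
  simp_rw [h]
  rw [integral_prod_mul (f := fun u : ℝ => Complex.exp (((x + y * c) * u : ℝ) * Complex.I))
    (g := fun v : ℝ => Complex.exp (((y * √(1 - c ^ 2)) * v : ℝ) * Complex.I)),
    integral_cexp_gaussianReal, integral_cexp_gaussianReal, ← Complex.exp_add, mul_pow,
    Real.sq_sqrt (by linarith)]
  congr 1
  push_cast
  ring

lemma measurable_bivariateNormalPDF (c : ℝ) :
    Measurable fun p : ℝ × ℝ => bivariateNormalPDF c p.1 p.2 := by
  unfold bivariateNormalPDF; fun_prop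

lemma bivariateNormalPDF_nonneg (c x y : ℝ) : 0 ≤ bivariateNormalPDF c x y := by
  unfold bivariateNormalPDF; positivity

lemma bivariateNormalPDF_eq_mul {c : ℝ} (hc : c ^ 2 < 1) (x y : ℝ) :
    bivariateNormalPDF c x y =
      gaussianPDFReal 0 1 x * gaussianPDFReal (c * x) (1 - c ^ 2).toNNReal y := by
  have h1 : 0 < 1 - c ^ 2 := by linarith
  simp only [bivariateNormalPDF, gaussianPDFReal, Real.coe_toNNReal _ h1.le, NNReal.coe_one,
    sub_zero, mul_one]
  rw [mul_mul_mul_comm, ← Real.exp_add]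
  congr 1
  · rw [← mul_inv, ← Real.sqrt_mul (by positivity), one_div]
    congr 1
    rw [show 2 * Real.pi * (2 * Real.pi * (1 - c ^ 2)) = (2 * Real.pi) ^ 2 * (1 - c ^ 2) by ring,
      Real.sqrt_mul (by positivity), Real.sqrt_sq (by positivity)]
  · congr 1
    field_simp
    ring

/-- Given the first coordinate `x`, the second is Gaussian with mean `c * x` and variance `1 - c ^
2`, nonzero by `hc`. This links the construction suited to characteristic functions with the density
occurring in `patternStability`. -/
lemma bivariateNormal_eq_withDensity {c : ℝ} (hc : c ^ 2 < 1) :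
    bivariateNormal c = (volume : Measure (ℝ × ℝ)).withDensity
      fun p => ENNReal.ofReal (bivariateNormalPDF c p.1 p.2) := by
  have h1 : 0 < 1 - c ^ 2 := by linarith
  have hv : (1 - c ^ 2).toNNReal ≠ 0 := by simpa using h1
  ext s hs
  have hf : Measurable fun p : ℝ × ℝ => (p.1, c * p.1 + √(1 - c ^ 2) * p.2) := by fun_prop
  have hpdf := (measurable_bivariateNormalPDF c).ennreal_ofReal
  rw [bivariateNormal, Measure.map_apply hf hs, Measure.prod_apply (hf hs),
    withDensity_apply _ hs, ← lintegral_indicator hs, Measure.volume_eq_prod,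
    lintegral_prod _ (hpdf.indicator hs).aemeasurable,
    gaussianReal_of_var_ne_zero _ one_ne_zero,
    lintegral_withDensity_eq_lintegral_mul₀ (measurable_gaussianPDF 0 1).aemeasurable]
  · refine lintegral_congr fun x => ?_
    have hmap : (gaussianReal 0 1).map (fun y => c * x + √(1 - c ^ 2) * y) =
        gaussianReal (c * x) (1 - c ^ 2).toNNReal := by
      have h2 := gaussianReal_map_const_mul (μ := 0) (v := 1) (√(1 - c ^ 2))
      have h3 := gaussianReal_map_const_add (μ := 0) (v := (1 - c ^ 2).toNNReal) (c * x)
      have h4 : NNReal.mk (√(1 - c ^ 2) ^ 2) (sq_nonneg _) * 1 = (1 - c ^ 2).toNNReal := by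
        ext; simp [Real.sq_sqrt h1.le, h1.le]
      rw [h4, mul_zero] at h2
      rw [← h2, Measure.map_map (by fun_prop) (by fun_prop), zero_add] at h3
      exact h3
    have hs' : MeasurableSet (Prod.mk x ⁻¹' s) := measurable_prodMk_left hs
    have h5 : (gaussianReal 0 1) (Prod.mk x ⁻¹' ((fun p : ℝ × ℝ =>
        (p.1, c * p.1 + √(1 - c ^ 2) * p.2)) ⁻¹' s)) =
        gaussianReal (c * x) (1 - c ^ 2).toNNReal (Prod.mk x ⁻¹' s) := by
      rw [← hmap, Measure.map_apply (by fun_prop) hs']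
      rfl
    rw [gaussianReal_of_var_ne_zero _ one_ne_zero] at h5
    simp only [Pi.mul_apply]
    rw [h5, gaussianReal_apply _ hv, ← lintegral_indicator hs',
      ← lintegral_const_mul _ ((measurable_gaussianPDF _ _).indicator hs')]
    refine lintegral_congr fun y => ?_
    by_cases hy : (x, y) ∈ s
    · rw [Set.indicator_of_mem (show y ∈ Prod.mk x ⁻¹' s from hy), Set.indicator_of_mem hy,
        bivariateNormalPDF_eq_mul hc, ENNReal.ofReal_mul (gaussianPDFReal_nonneg _ _ _)]
      rfl
    · rw [Set.indicator_of_notMem (show y ∉ Prod.mk x ⁻¹' s from hy), Set.indicator_of_notMem hy,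
        mul_zero]
  · rw [← gaussianReal_of_var_ne_zero _ one_ne_zero]
    exact (measurable_measure_prodMk_left (hf hs)).aemeasurable

lemma bivariateNormal_fst_eq_zero {c : ℝ} (hc : c ^ 2 < 1) (a : ℝ) :
    bivariateNormal c {p | p.1 = a} = 0 := by
  rw [bivariateNormal_eq_withDensity hc]
  refine withDensity_absolutelyContinuous _ _ ?_
  have : {p : ℝ × ℝ | p.1 = a} = {a} ×ˢ Set.univ := by ext p; simp
  rw [this, Measure.volume_eq_prod, Measure.prod_prod]
  simp

lemma bivariateNormal_snd_eq_zero {c : ℝ} (hc : c ^ 2 < 1) (a : ℝ) :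
    bivariateNormal c {p | p.2 = a} = 0 := by
  rw [bivariateNormal_eq_withDensity hc]
  refine withDensity_absolutelyContinuous _ _ ?_
  have : {p : ℝ × ℝ | p.2 = a} = Set.univ ×ˢ {a} := by ext p; simp
  rw [this, Measure.volume_eq_prod, Measure.prod_prod]
  simp

/-- By Fubini: once the value at one index is fixed, a tie confines the other to a level set of `f`,
which is null. -/
lemma ae_pi_ne {ι E : Type*} [Fintype ι] [MeasurableSpace E] {μ : Measure E}
    [IsProbabilityMeasure μ] {f : E → ℝ} (hf : Measurable f) (h0 : ∀ a, μ {p | f p = a} = 0)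
    {j k : ι} (hjk : j ≠ k) : ∀ᵐ e ∂(Measure.pi fun _ : ι => μ), f (e j) ≠ f (e k) := by
  have hm : MeasurableSet {p : E × E | f p.1 = f p.2} :=
    measurableSet_eq_fun (by fun_prop) (by fun_prop)
  have h1 : ∀ᵐ p ∂(μ.prod μ), f p.1 ≠ f p.2 := by
    rw [ae_iff]
    simp only [not_not]
    rw [Measure.measure_prod_null hm]
    refine .of_forall fun p => ?_
    have : Prod.mk p ⁻¹' {p : E × E | f p.1 = f p.2} = {q | f q = f p} := by
      ext q; simp [eq_comm]
    exact (congrArg μ this).trans (h0 _)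
  have hmeas : Measurable fun e : ι → E => (e j, e k) := by fun_prop
  have := (hasLaw_eval_pair μ hjk).map_eq
  rw [← this] at h1
  exact ae_of_ae_map hmeas.aemeasurable h1

lemma exists_isArgmax_of_injective {n : ℕ} [NeZero n] {v : Fin n → ℝ} (hv : Function.Injective v) :
    ∃ k, IsArgmax v k := by
  obtain ⟨k, hk⟩ := Finite.exists_max v
  exact ⟨k, fun j hj => lt_of_le_of_ne (hk j) fun h => hj (hv h)⟩

end

/-! ### The Gaussian limit of the scores, its pattern probabilities and `s(ρ)`. -/

noncomputable section

variable {n : ℕ} {R : Type*} [Fintype R]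

/-- The correlation between the copies `X r = (r, false)` and `Y r = (r, true)`. -/
def replicaCorr [DecidableEq R] (ρ : ℝ) (a b : R × Bool) : ℝ :=
  if a.1 = b.1 then (if a.2 = b.2 then 1 else ρ) else 0

/-- Independent bivariate normal pairs, one for each replica and row. -/
def limitMeasure (R : Type*) [Fintype R] (n : ℕ) (c : ℝ) : Measure (R → Fin n → ℝ × ℝ) :=
  Measure.pi fun _ => Measure.pi fun _ => bivariateNormal c

instance (c : ℝ) : IsProbabilityMeasure (limitMeasure R n c) := by
  unfold limitMeasure; infer_instance

/-- The score rows read off from the pairs. -/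
def limitScores (ξ : R → Fin n → ℝ × ℝ) (a : R × Bool) (k : Fin n) : ℝ :=
  if a.2 then (ξ a.1 k).2 else (ξ a.1 k).1

lemma integral_cexp_limitScores [DecidableEq R] {ρ : ℝ} (hρ : (ρ ^ 2) ^ 2 ≤ 1)
    (t : (R × Bool) × Fin n → ℝ) :
    ∫ ξ, Complex.exp ((∑ a, t a * limitScores ξ a.1 a.2 : ℝ) * Complex.I)
      ∂limitMeasure R n (ρ ^ 2) =
      Complex.exp (-(∑ a : (R × Bool) × Fin n, ∑ b : (R × Bool) × Fin n,
        t a * t b * (replicaCorr ρ a.1 b.1 *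
          if a.2 = b.2 then replicaCorr ρ a.1 b.1 else 0) : ℝ) / 2) := by
  have h1 : ∀ ξ : R → Fin n → ℝ × ℝ,
      Complex.exp ((∑ a, t a * limitScores ξ a.1 a.2 : ℝ) * Complex.I) =
      ∏ r, ∏ k, Complex.exp ((t ((r, false), k) * (ξ r k).1 + t ((r, true), k) * (ξ r k).2 : ℝ) *
        Complex.I) := by
    intro ξ
    simp_rw [← Complex.exp_sum]
    congr 1
    simp_rw [← Finset.sum_mul, ← Complex.ofReal_sum]
    congr 2
    simp only [Fintype.sum_prod_type, Fintype.sum_bool, limitScores, if_true,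
      Bool.false_eq_true, if_false, Finset.sum_add_distrib]
    exact add_comm _ _
  simp_rw [h1]
  rw [limitMeasure, integral_fintype_prod_eq_prod (f := fun r (η : Fin n → ℝ × ℝ) =>
    ∏ k, Complex.exp ((t ((r, false), k) * (η k).1 + t ((r, true), k) * (η k).2 : ℝ) *
        Complex.I))]
  have h2 : ∀ r, ∫ η, ∏ k, Complex.exp ((t ((r, false), k) * (η k).1 +
      t ((r, true), k) * (η k).2 : ℝ) * Complex.I)
        ∂(Measure.pi fun _ : Fin n => bivariateNormal (ρ ^ 2)) =
      ∏ k, Complex.exp (-(t ((r, false), k) ^ 2 + 2 * ρ ^ 2 * t ((r, false), k) *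
        t ((r, true), k) + t ((r, true), k) ^ 2 : ℝ) / 2) := by
    intro r
    rw [integral_fintype_prod_eq_prod (f := fun k (p : ℝ × ℝ) =>
      Complex.exp ((t ((r, false), k) * p.1 + t ((r, true), k) * p.2 : ℝ) * Complex.I))]
    simp_rw [integral_cexp_bivariateNormal hρ]
  simp_rw [h2, ← Complex.exp_sum]
  congr 1
  simp_rw [← Finset.sum_div, Finset.sum_neg_distrib, ← Complex.ofReal_sum]
  congr 3
  -- Only two terms of the inner sum survive: the index itself, and the other copy in the same
  -- replica and row, where `replicaCorr` enters twice and produces `ρ ^ 2`.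
  have h3 : ∀ (r : R) (b : Bool) (k : Fin n), ∑ b' : (R × Bool) × Fin n,
      t ((r, b), k) * t b' * (replicaCorr ρ (r, b) b'.1 *
        if k = b'.2 then replicaCorr ρ (r, b) b'.1 else 0) =
      t ((r, b), k) ^ 2 + ρ ^ 2 * t ((r, b), k) * t ((r, !b), k) := by
    intro r b k
    simp only [Fintype.sum_prod_type, replicaCorr, mul_ite, ite_mul, mul_zero, zero_mul,
      Finset.sum_ite_eq, Finset.mem_univ, if_true]
    rw [Finset.sum_comm]
    simp only [Finset.sum_ite_eq, Finset.mem_univ, if_true, Fintype.sum_bool]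
    cases b <;> simp <;> ring
  simp only [h3]
  rw [Fintype.sum_prod_type, Fintype.sum_prod_type]
  refine Finset.sum_congr rfl fun r _ => ?_
  rw [Fintype.sum_bool, ← Finset.sum_add_distrib]
  exact Finset.sum_congr rfl fun k _ => by simp only [Bool.not_true, Bool.not_false]; ring

lemma isScoreLimit_limitScores [DecidableEq R] [NeZero n] {ρ : ℝ} (hρ : ρ ^ 2 < 1) :
    IsScoreLimit (replicaCorr (R := R) ρ) (limitMeasure R n (ρ ^ 2)) limitScores where
  measurable := by
    refine measurable_pi_iff.2 fun a => measurable_pi_iff.2 fun k => ?_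
    unfold limitScores
    split_ifs <;> fun_prop
  integral_cexp := integral_cexp_limitScores (by nlinarith [sq_nonneg ρ])
  ae_exists_isArgmax := by
    have hc : (ρ ^ 2) ^ 2 < 1 := by nlinarith [sq_nonneg ρ]
    have h1 : ∀ᵐ η ∂(Measure.pi fun _ : Fin n => bivariateNormal (ρ ^ 2)), ∀ j k, j ≠ k →
        (η j).1 ≠ (η k).1 ∧ (η j).2 ≠ (η k).2 := by
      rw [ae_all_iff]; intro j
      rw [ae_all_iff]; intro k
      by_cases hjk : j = k
      · exact .of_forall fun _ h => absurd hjk h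
      · filter_upwards [ae_pi_ne measurable_fst (bivariateNormal_fst_eq_zero hc) hjk,
          ae_pi_ne measurable_snd (bivariateNormal_snd_eq_zero hc) hjk] with η h1 h2 _
        exact ⟨h1, h2⟩
    have h2 : ∀ᵐ ξ ∂limitMeasure R n (ρ ^ 2), ∀ r, ∀ j k, j ≠ k →
        (ξ r j).1 ≠ (ξ r k).1 ∧ (ξ r j).2 ≠ (ξ r k).2 := by
      rw [ae_all_iff]; intro r
      exact (Measure.quasiMeasurePreserving_eval
        (fun _ : R => Measure.pi fun _ : Fin n => bivariateNormal (ρ ^ 2)) r).ae h1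
    filter_upwards [h2] with ξ hξ a
    refine exists_isArgmax_of_injective fun j k hjk => ?_
    by_contra hne
    unfold limitScores at hjk
    split_ifs at hjk
    · exact (hξ a.1 j k hne).2 hjk
    · exact (hξ a.1 j k hne).1 hjk

/-- The probability that the maxima of the two coordinates of `n` independent bivariate normal
pairs are at the positions `κ false` and `κ true`. -/
def pairPatternProb (c : ℝ) (κ : Bool → Fin n) : ℝ :=
  (Measure.pi fun _ : Fin n => bivariateNormal c).real
    {η | IsArgmax (fun k => (η k).1) (κ false) ∧ IsArgmax (fun k => (η k).2) (κ true)}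

/-- The replicas are independent in the limit. This factorization later turns the limit of an `r`-th
moment into an `r`-th power. -/
lemma patternProb_limitScores (c : ℝ) (κ : R × Bool → Fin n) :
    patternProb (limitMeasure R n c) limitScores κ =
      ∏ r, pairPatternProb c fun b => κ (r, b) := by
  have h : {ξ : R → Fin n → ℝ × ℝ | ∀ a, IsArgmax (limitScores ξ a) (κ a)} =
      Set.univ.pi fun r => {η | IsArgmax (fun k => (η k).1) (κ (r, false)) ∧
        IsArgmax (fun k => (η k).2) (κ (r, true))} := by
    ext ξ
    simp only [Set.mem_ofPred_eq, Set.mem_pi, Set.mem_univ, true_imp_iff, Prod.forall,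
      Bool.forall_bool]
    rfl
  rw [patternProb, h, limitMeasure, Measure.real, Measure.pi_pi, ENNReal.toReal_prod]
  rfl

lemma integrable_bivariateNormalPDF {c : ℝ} (hc : c ^ 2 < 1) :
    Integrable fun p : ℝ × ℝ => bivariateNormalPDF c p.1 p.2 := by
  refine ⟨(measurable_bivariateNormalPDF c).aestronglyMeasurable, ?_⟩
  rw [hasFiniteIntegral_iff_ofReal (.of_forall fun p => bivariateNormalPDF_nonneg _ _ _)]
  have := measure_univ (μ := bivariateNormal c)
  rw [bivariateNormal_eq_withDensity hc, withDensity_apply _ .univ, setLIntegral_univ] at this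
  rw [this]
  exact ENNReal.one_lt_top

/-- Strict maxima lead to open quadrants, while `bivariateNormalCDF` integrates over closed ones;
the boundary is a null set. -/
lemma bivariateNormal_real_Iio {c : ℝ} (hc : c ^ 2 < 1) (x y : ℝ) :
    (bivariateNormal c).real (Set.Iio x ×ˢ Set.Iio y) = bivariateNormalCDF c x y := by
  have hs : MeasurableSet (Set.Iio x ×ˢ Set.Iio y) := measurableSet_Iio.prod measurableSet_Iio
  rw [Measure.real, bivariateNormal_eq_withDensity hc, withDensity_apply _ hs,
    ← ofReal_integral_eq_lintegral_ofReal (integrable_bivariateNormalPDF hc).integrableOn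
      (.of_forall fun p => bivariateNormalPDF_nonneg _ _ _),
    ENNReal.toReal_ofReal (integral_nonneg fun p => bivariateNormalPDF_nonneg _ _ _),
    bivariateNormalCDF, Measure.volume_eq_prod,
    setIntegral_congr_set (Measure.set_prod_ae_eq Iio_ae_eq_Iic Iio_ae_eq_Iic),
    setIntegral_prod]
  exact (integrable_bivariateNormalPDF hc).integrableOn

lemma measurable_bivariateNormalCDF {c : ℝ} (hc : c ^ 2 < 1) :
    Measurable fun p : ℝ × ℝ => bivariateNormalCDF c p.1 p.2 := by
  simp_rw [← bivariateNormal_real_Iio hc]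
  have hs : MeasurableSet {q : (ℝ × ℝ) × (ℝ × ℝ) | q.2.1 < q.1.1 ∧ q.2.2 < q.1.2} := by
    rw [Set.ofPred_and]
    exact (measurableSet_lt (by fun_prop) (by fun_prop)).inter
      (measurableSet_lt (by fun_prop) (by fun_prop))
  exact (measurable_measure_prodMk_left (ν := bivariateNormal c) hs).ennreal_toReal

/-- Split off the pair at position `k`. Given its value `(x, y)`, the other `m` pairs must
independently fall in the quadrant below it, which has probability `bivariateNormalCDF c x y ^ m`.
-/
lemma pairPatternProb_const {m : ℕ} {c : ℝ} (hc : c ^ 2 < 1) (k : Fin (m + 1)) :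
    pairPatternProb c (fun _ => k) = ∫ x, ∫ y, bivariateNormalCDF c x y ^ m *
      bivariateNormalPDF c x y := by
  have hmp := measurePreserving_piFinSuccAbove (fun _ : Fin (m + 1) => bivariateNormal c) k
  let T : Set ((ℝ × ℝ) × (Fin m → ℝ × ℝ)) :=
    {q | ∀ j, (q.2 j).1 < q.1.1 ∧ (q.2 j).2 < q.1.2}
  have hT : MeasurableSet T := by
    have : T = ⋂ j, {q | (q.2 j).1 < q.1.1 ∧ (q.2 j).2 < q.1.2} := by ext; simp [T]
    rw [this]
    refine MeasurableSet.iInter fun j => ?_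
    rw [Set.ofPred_and]
    exact (measurableSet_lt (by fun_prop) (by fun_prop)).inter
      (measurableSet_lt (by fun_prop) (by fun_prop))
  have hset : {η : Fin (m + 1) → ℝ × ℝ | IsArgmax (fun l => (η l).1) k ∧
      IsArgmax (fun l => (η l).2) k} =
      MeasurableEquiv.piFinSuccAbove (fun _ => ℝ × ℝ) k ⁻¹' T := by
    ext η
    simp only [Set.mem_ofPred_eq, Set.mem_preimage, T, IsArgmax]
    constructor
    · rintro ⟨h1, h2⟩ j
      exact ⟨h1 _ (Fin.succAbove_ne k j), h2 _ (Fin.succAbove_ne k j)⟩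
    · intro h
      constructor
      · intro j hj
        obtain ⟨l, rfl⟩ := Fin.exists_succAbove_eq hj
        exact (h l).1
      · intro j hj
        obtain ⟨l, rfl⟩ := Fin.exists_succAbove_eq hj
        exact (h l).2
  have hsec : ∀ p : ℝ × ℝ, (Measure.pi fun _ : Fin m => bivariateNormal c) (Prod.mk p ⁻¹' T) =
      bivariateNormal c (Set.Iio p.1 ×ˢ Set.Iio p.2) ^ m := by
    intro p
    have : Prod.mk p ⁻¹' T = Set.univ.pi fun _ => Set.Iio p.1 ×ˢ Set.Iio p.2 := by
      ext η; simp [T]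
    rw [this, Measure.pi_pi]
    simp
  have hpdf := measurable_bivariateNormalPDF c
  rw [pairPatternProb, hset, hmp.measureReal_preimage hT.nullMeasurableSet, Measure.real,
    Measure.prod_apply hT]
  simp_rw [hsec]
  have h1 : ∀ p : ℝ × ℝ, bivariateNormal c (Set.Iio p.1 ×ˢ Set.Iio p.2) ^ m =
      ENNReal.ofReal (bivariateNormalCDF c p.1 p.2 ^ m) := by
    intro p
    rw [← bivariateNormal_real_Iio hc, ENNReal.ofReal_pow measureReal_nonneg,
      ofReal_measureReal]
  have hCDF0 : ∀ p : ℝ × ℝ, 0 ≤ bivariateNormalCDF c p.1 p.2 := fun p => by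
    rw [← bivariateNormal_real_Iio hc]; exact measureReal_nonneg
  have hCDF1 : ∀ p : ℝ × ℝ, bivariateNormalCDF c p.1 p.2 ≤ 1 := fun p => by
    rw [← bivariateNormal_real_Iio hc]; exact measureReal_le_one
  have hfint : Integrable fun p : ℝ × ℝ => bivariateNormalCDF c p.1 p.2 ^ m *
      bivariateNormalPDF c p.1 p.2 := by
    refine (integrable_bivariateNormalPDF hc).bdd_mul (c := 1)
      ((measurable_bivariateNormalCDF hc).pow_const m).aestronglyMeasurable
      (.of_forall fun p => ?_)
    rw [Real.norm_eq_abs, abs_of_nonneg (pow_nonneg (hCDF0 p) m)]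
    exact pow_le_one₀ (hCDF0 p) (hCDF1 p)
  simp_rw [h1]
  rw [bivariateNormal_eq_withDensity hc, lintegral_withDensity_eq_lintegral_mul _
    hpdf.ennreal_ofReal ((measurable_bivariateNormalCDF hc).pow_const m).ennreal_ofReal]
  have h2 : ∀ p : ℝ × ℝ, ((fun p : ℝ × ℝ => ENNReal.ofReal (bivariateNormalPDF c p.1 p.2)) *
      fun p : ℝ × ℝ => ENNReal.ofReal (bivariateNormalCDF c p.1 p.2 ^ m)) p =
      ENNReal.ofReal (bivariateNormalCDF c p.1 p.2 ^ m * bivariateNormalPDF c p.1 p.2) := by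
    intro p
    rw [Pi.mul_apply, mul_comm, ENNReal.ofReal_mul (pow_nonneg (hCDF0 p) m)]
  simp_rw [h2]
  have hnn : ∀ p : ℝ × ℝ, 0 ≤ bivariateNormalCDF c p.1 p.2 ^ m * bivariateNormalPDF c p.1 p.2 :=
    fun p => mul_nonneg (pow_nonneg (hCDF0 p) m) (bivariateNormalPDF_nonneg _ _ _)
  rw [← ofReal_integral_eq_lintegral_ofReal hfint (.of_forall hnn),
    ENNReal.toReal_ofReal (integral_nonneg hnn)]
  rw [Measure.volume_eq_prod] at hfint ⊢
  exact integral_prod _ hfint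

lemma sum_pairPatternProb [NeZero n] {ρ : ℝ} (hρ : ρ ^ 2 < 1) :
    ∑ k : Fin n, pairPatternProb (ρ ^ 2) (fun _ => k) = patternStability n ρ := by
  have hc : (ρ ^ 2) ^ 2 < 1 := by nlinarith [sq_nonneg ρ]
  obtain ⟨m, rfl⟩ := Nat.exists_eq_succ_of_ne_zero (NeZero.ne n)
  simp [pairPatternProb_const hc, patternStability]

end

/-! ### Replicas of the data and concentration of their Gram matrix. -/

noncomputable section

variable {n d : ℕ} {R : Type*} [Fintype R]

/-- The law of the pair `(X, Z)` of independent Gaussian matrices. -/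
def pairMeasure (n d : ℕ) : Measure (Matrix (Fin n) (Fin d) ℝ × Matrix (Fin n) (Fin d) ℝ) :=
  (stdGaussianMatrix n d).prod (stdGaussianMatrix n d)

instance (n d : ℕ) : IsProbabilityMeasure (pairMeasure n d) := by
  unfold pairMeasure; infer_instance

/-- The `k`-th row of `X` or of `Z`. -/
def pairRow (p : Matrix (Fin n) (Fin d) ℝ × Matrix (Fin n) (Fin d) ℝ) (s : Bool) (k : Fin n) :
    Fin d → ℝ :=
  (if s then p.2 else p.1) k

lemma measurePreserving_row (k : Fin n) :
    MeasurePreserving (fun X : Matrix (Fin n) (Fin d) ℝ => X k) (stdGaussianMatrix n d)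
      (gaussVec d) :=
  measurePreserving_eval (fun _ : Fin n => gaussVec d) k

lemma measurePreserving_pairRow (s : Bool) (k : Fin n) :
    MeasurePreserving (fun p => pairRow p s k) (pairMeasure n d) (gaussVec d) := by
  cases s
  · exact (measurePreserving_row k).comp measurePreserving_fst
  · exact (measurePreserving_row k).comp measurePreserving_snd

/-- Pairwise independence of rows is enough: the Gram matrix is controlled through second moments of
single inner products. -/
lemma hasLaw_pairRow_pair {s s' : Bool} {k k' : Fin n} (h : (s, k) ≠ (s', k')) :
    HasLaw (fun p => (pairRow p s k, pairRow p s' k')) ((gaussVec d).prod (gaussVec d))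
      (pairMeasure n d) := by
  have hmix : ∀ k k' : Fin n,
      HasLaw (fun p => (pairRow p false k, pairRow p true k')) ((gaussVec d).prod (gaussVec d))
        (pairMeasure n d) := fun k k' =>
    ((measurePreserving_row k).prod (measurePreserving_row k')).hasLaw
  have hswap : HasLaw Prod.swap ((gaussVec d).prod (gaussVec d))
      ((gaussVec d).prod (gaussVec d)) := Measure.measurePreserving_swap.hasLaw
  cases s <;> cases s'
  · have hk : k ≠ k' := fun hk => h (by rw [hk])
    exact (hasLaw_eval_pair (gaussVec d) hk).comp
      (measurePreserving_fst (μ := stdGaussianMatrix n d) (ν := stdGaussianMatrix n d)).hasLaw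
  · exact hmix k k'
  · exact hswap.comp (hmix k' k)
  · have hk : k ≠ k' := fun hk => h (by rw [hk])
    exact (hasLaw_eval_pair (gaussVec d) hk).comp
      (measurePreserving_snd (μ := stdGaussianMatrix n d) (ν := stdGaussianMatrix n d)).hasLaw

/-- Independent replicas of the pair `(X, Z)`. -/
def replicaMeasure (R : Type*) [Fintype R] (n d : ℕ) :
    Measure (R → Matrix (Fin n) (Fin d) ℝ × Matrix (Fin n) (Fin d) ℝ) :=
  Measure.pi fun _ => pairMeasure n d

instance : IsProbabilityMeasure (replicaMeasure R n d) := by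
  unfold replicaMeasure; infer_instance

lemma measurePreserving_replicaRow (r : R) (s : Bool) (k : Fin n) :
    MeasurePreserving (fun p : R → _ => pairRow (p r) s k) (replicaMeasure R n d) (gaussVec d) :=
  (measurePreserving_pairRow s k).comp (measurePreserving_eval (fun _ : R => pairMeasure n d) r)

lemma hasLaw_replicaRow_pair {r r' : R} {s s' : Bool} {k k' : Fin n}
    (h : (r, s, k) ≠ (r', s', k')) :
    HasLaw (fun p : R → _ => (pairRow (p r) s k, pairRow (p r') s' k'))
      ((gaussVec d).prod (gaussVec d)) (replicaMeasure R n d) := by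
  by_cases hr : r = r'
  · subst hr
    exact (hasLaw_pairRow_pair (fun hs => h (by simp_all))).comp
      (measurePreserving_eval (fun _ : R => pairMeasure n d) r).hasLaw
  · exact ((measurePreserving_pairRow s k).prod (measurePreserving_pairRow s' k')).hasLaw.comp
      (hasLaw_eval_pair (pairMeasure n d) hr)

/-- The squared deviation of a normalized inner product of two of the Gaussian rows. -/
def rowDev [DecidableEq R] (p : R → Matrix (Fin n) (Fin d) ℝ × Matrix (Fin n) (Fin d) ℝ)
    (α β : R × Bool × Fin n) : ℝ :=
  (pairRow (p α.1) α.2.1 α.2.2 ⬝ᵥ pairRow (p β.1) β.2.1 β.2.2) / d - if α = β then 1 else 0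

lemma integrable_rowDev_sq [DecidableEq R] (α β : R × Bool × Fin n) :
    Integrable (fun p => rowDev p α β ^ 2) (replicaMeasure R n d) := by
  obtain ⟨r, s, k⟩ := α
  by_cases h : (r, s, k) = β
  · subst h
    simp only [rowDev, if_true]
    have hm := measurePreserving_replicaRow (R := R) (d := d) r s k
    have h1 : Integrable (fun v : Fin d → ℝ => ((v ⬝ᵥ v) / d - 1) ^ 2) (gaussVec d) :=
      (((memLp_dotProduct_self d).mul_const (d : ℝ)⁻¹).sub (memLp_const (1 : ℝ))).integrable_sq
    exact hm.integrable_comp_of_integrable h1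
  · obtain ⟨r', s', k'⟩ := β
    simp only [rowDev, if_neg h, sub_zero]
    have hl := hasLaw_replicaRow_pair (d := d) h
    have h1 : Integrable (fun q : (Fin d → ℝ) × (Fin d → ℝ) => ((q.1 ⬝ᵥ q.2) / d) ^ 2)
        ((gaussVec d).prod (gaussVec d)) := by
      simp only [div_pow]
      exact (integrable_prod_dotProduct_sq d).div_const _
    rw [← hl.map_eq] at h1
    exact h1.comp_aemeasurable hl.aemeasurable

/-- For equal rows the mean square is the variance of `v ⬝ᵥ v / d`, that is `gaussSqVar / d`; for
distinct independent rows it is `1 / d`. The bound covers both. -/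
lemma integral_rowDev_sq_le [DecidableEq R] (hd : 0 < d) (α β : R × Bool × Fin n) :
    ∫ p, rowDev p α β ^ 2 ∂replicaMeasure R n d ≤ (1 + gaussSqVar) / d := by
  have hd' : (0 : ℝ) < d := by exact_mod_cast hd
  have hv : 0 ≤ gaussSqVar := variance_nonneg _ _
  obtain ⟨r, s, k⟩ := α
  by_cases h : (r, s, k) = β
  · subst h
    simp only [rowDev, if_true]
    have hl := (measurePreserving_replicaRow (R := R) (d := d) r s k).hasLaw
    have h1 : Continuous fun v : Fin d → ℝ => ((v ⬝ᵥ v) / d - 1) ^ 2 := by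
      unfold dotProduct; fun_prop
    refine (hl.integral_comp h1.aestronglyMeasurable).trans_le ?_
    have h2 : ∀ v : Fin d → ℝ, ((v ⬝ᵥ v) / d - 1) ^ 2 = (v ⬝ᵥ v - d) ^ 2 / d ^ 2 := by
      intro v; field_simp
    simp_rw [h2]
    rw [integral_div, integral_dotProduct_self_sub_sq, sq, mul_div_mul_left _ _ hd'.ne']
    gcongr
    linarith
  · obtain ⟨r', s', k'⟩ := β
    simp only [rowDev, if_neg h, sub_zero]
    have hl := hasLaw_replicaRow_pair (d := d) h
    have h1 : Continuous fun q : (Fin d → ℝ) × (Fin d → ℝ) => ((q.1 ⬝ᵥ q.2) / d) ^ 2 := by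
      unfold dotProduct; fun_prop
    refine (hl.integral_comp h1.aestronglyMeasurable).trans_le ?_
    simp only [div_pow]
    rw [integral_div, integral_prod_dotProduct_sq, sq, div_mul_cancel_left₀ hd'.ne', inv_eq_one_div]
    gcongr
    linarith

/-- The matrices `X` and `Y = ρ X + √(1 - ρ²) Z`. -/
def pairMix (ρ : ℝ) (p : Matrix (Fin n) (Fin d) ℝ × Matrix (Fin n) (Fin d) ℝ)
    (b : Bool) : Matrix (Fin n) (Fin d) ℝ :=
  if b then ρ • p.1 + √(1 - ρ ^ 2) • p.2 else p.1

/-- The matrices `X r` and `Y r` of all replicas. -/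
def replicas {R : Type*} (ρ : ℝ) (p : R → Matrix (Fin n) (Fin d) ℝ × Matrix (Fin n) (Fin d) ℝ)
    (a : R × Bool) : Matrix (Fin n) (Fin d) ℝ :=
  pairMix ρ (p a.1) a.2

/-- The coefficients of `X` and `Y` in terms of `X` and `Z`. -/
def mixCoeff (ρ : ℝ) (b s : Bool) : ℝ :=
  if b then (if s then √(1 - ρ ^ 2) else ρ) else (if s then 0 else 1)

lemma abs_mixCoeff_le {ρ : ℝ} (hρ : ρ ^ 2 < 1) (b s : Bool) : |mixCoeff ρ b s| ≤ 1 := by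
  have h1 : |ρ| ≤ 1 := (sq_le_one_iff_abs_le_one _).1 hρ.le
  have h2 : √(1 - ρ ^ 2) ≤ 1 := Real.sqrt_le_one.2 (by nlinarith [sq_nonneg ρ])
  cases b <;> cases s <;> simp [mixCoeff, h1, h2, abs_of_nonneg (Real.sqrt_nonneg _)]

lemma pairMix_row (ρ : ℝ) (p : Matrix (Fin n) (Fin d) ℝ × Matrix (Fin n) (Fin d) ℝ)
    (b : Bool) (k : Fin n) :
    pairMix ρ p b k = ∑ s, mixCoeff ρ b s • pairRow p s k := by
  cases b
  · simp [pairMix, mixCoeff, pairRow]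
  · simp only [pairMix, mixCoeff, pairRow, if_true, Fintype.sum_bool, Bool.false_eq_true,
      if_false]
    exact add_comm _ _

lemma continuous_pairMix (ρ : ℝ) (b : Bool) : Continuous fun
    p : Matrix (Fin n) (Fin d) ℝ × Matrix (Fin n) (Fin d) ℝ => pairMix ρ p b := by
  unfold pairMix
  split_ifs <;> fun_prop

lemma continuous_replicas {R : Type*} (ρ : ℝ) : Continuous fun
    p : R → Matrix (Fin n) (Fin d) ℝ × Matrix (Fin n) (Fin d) ℝ => replicas ρ p :=
  continuous_pi fun a => (continuous_pairMix ρ a.2).comp (continuous_apply a.1)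

/-- The coefficient vectors `(1, 0)` of `X` and `(ρ, √(1 - ρ ^ 2))` of `Y` have unit norm and inner
product `ρ`. -/
lemma sum_mixCoeff {R : Type*} [DecidableEq R] {ρ : ℝ} (hρ : ρ ^ 2 < 1) (a b : R × Bool) (k l : Fin n) :
    ∑ q : Bool × Bool, mixCoeff ρ a.2 q.1 * mixCoeff ρ b.2 q.2 *
      (if (a.1, q.1, k) = (b.1, q.2, l) then 1 else 0) =
      if k = l then replicaCorr ρ a b else 0 := by
  obtain ⟨r, s⟩ := a
  obtain ⟨r', s'⟩ := b
  have h1 : √(1 - ρ ^ 2) * √(1 - ρ ^ 2) = 1 - ρ ^ 2 := Real.mul_self_sqrt (by linarith)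
  by_cases hr : r = r' <;> by_cases hk : k = l <;> cases s <;> cases s' <;>
    simp [Fintype.sum_prod_type, mixCoeff, replicaCorr, hr, hk, h1]
  ring

/-- By bilinearity each entry is a combination of four row deviations with coefficients of modulus
at most `1`; Cauchy–Schwarz for four terms gives the factor `4`. -/
lemma gramDev_replicas_le [DecidableEq R] {ρ : ℝ} (hρ : ρ ^ 2 < 1)
    (p : R → Matrix (Fin n) (Fin d) ℝ × Matrix (Fin n) (Fin d) ℝ) :
    gramDev (replicaCorr ρ) (replicas ρ p) ≤
      ∑ a : (R × Bool) × Fin n, ∑ b : (R × Bool) × Fin n, 4 * ∑ q : Bool × Bool,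
        rowDev p (a.1.1, q.1, a.2) (b.1.1, q.2, b.2) ^ 2 := by
  refine Finset.sum_le_sum fun a _ => Finset.sum_le_sum fun b _ => ?_
  have h1 : (replicas ρ p a.1 a.2 ⬝ᵥ replicas ρ p b.1 b.2) / d -
      (if a.2 = b.2 then replicaCorr ρ a.1 b.1 else 0) =
      ∑ q : Bool × Bool, mixCoeff ρ a.1.2 q.1 * mixCoeff ρ b.1.2 q.2 *
        rowDev p (a.1.1, q.1, a.2) (b.1.1, q.2, b.2) := by
    simp only [rowDev, mul_sub, Finset.sum_sub_distrib]
    rw [sum_mixCoeff hρ, replicas, replicas, pairMix_row, pairMix_row]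
    congr 1
    simp only [Fintype.sum_prod_type, Fintype.sum_bool, add_dotProduct, dotProduct_add,
      smul_dotProduct, dotProduct_smul, smul_eq_mul]
    ring
  rw [h1]
  refine (sq_sum_le_card_mul_sum_sq).trans ?_
  simp only [Finset.card_univ, Fintype.card_prod, Fintype.card_bool]
  norm_num
  refine Finset.sum_le_sum fun q _ => ?_
  rw [mul_pow, mul_pow]
  have h2 := (sq_le_one_iff_abs_le_one _).2 (abs_mixCoeff_le hρ a.1.2 q.1)
  have h3 := (sq_le_one_iff_abs_le_one _).2 (abs_mixCoeff_le hρ b.1.2 q.2)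
  exact mul_le_of_le_one_left (sq_nonneg _) (mul_le_one₀ h2 (sq_nonneg _) h3)

/-- The Gram matrix has a number of entries independent of `d`, each with mean square deviation of
order `1 / d`. -/
lemma gramTendsto_replicas [DecidableEq R] {ρ : ℝ} (hρ : ρ ^ 2 < 1) :
    GramTendsto (replicaMeasure R n) (replicaCorr ρ) fun _ => replicas ρ := by
  have hfint : ∀ d, Integrable (fun p : R → Matrix (Fin n) (Fin d) ℝ × Matrix (Fin n) (Fin d) ℝ =>
      ∑ a : (R × Bool) × Fin n, ∑ b : (R × Bool) × Fin n, 4 * ∑ q : Bool × Bool,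
        rowDev p (a.1.1, q.1, a.2) (b.1.1, q.2, b.2) ^ 2) (replicaMeasure R n d) := fun d =>
    integrable_finsetSum _ fun a _ => integrable_finsetSum _ fun b _ =>
      (integrable_finsetSum _ fun q _ => integrable_rowDev_sq _ _).const_mul _
  have hI : ∀ d, Integrable (fun p => gramDev (replicaCorr ρ) (replicas ρ p))
      (replicaMeasure R n d) := by
    intro d
    have hc : Continuous fun p : R → Matrix (Fin n) (Fin d) ℝ × Matrix (Fin n) (Fin d) ℝ =>
        gramDev (replicaCorr ρ) (replicas ρ p) := by
      have h : ∀ (a : R × Bool) (k : Fin n) (x : Fin d), Continuous fun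
          p : R → Matrix (Fin n) (Fin d) ℝ × Matrix (Fin n) (Fin d) ℝ => replicas ρ p a k x :=
        fun a k x => (continuous_apply_apply k x).comp
          ((continuous_apply a).comp (continuous_replicas ρ))
      unfold gramDev dotProduct
      fun_prop
    refine (hfint d).mono' hc.aestronglyMeasurable (.of_forall fun p => ?_)
    rw [Real.norm_eq_abs, abs_of_nonneg (gramDev_nonneg _ _)]
    exact gramDev_replicas_le hρ p
  refine ⟨hI, ?_⟩
  set N : ℝ := ∑ a : (R × Bool) × Fin n, ∑ b : (R × Bool) × Fin n, 4 * ∑ q : Bool × Bool,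
    (1 + gaussSqVar) with hN
  have hlim : Tendsto (fun d : ℕ => N / d) atTop (𝓝 0) := tendsto_const_div_atTop_nhds_zero_nat N
  refine squeeze_zero' (.of_forall fun d => integral_nonneg fun p => gramDev_nonneg _ _) ?_ hlim
  filter_upwards [eventually_gt_atTop 0] with d hd
  refine (integral_mono (hI d) (hfint d) fun p => gramDev_replicas_le hρ p).trans ?_
  rw [integral_finsetSum _ fun a _ => integrable_finsetSum _ fun b _ =>
      (integrable_finsetSum _ fun q _ => integrable_rowDev_sq _ _).const_mul _, hN, Finset.sum_div]
  refine Finset.sum_le_sum fun a _ => ?_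
  rw [integral_finsetSum _ fun b _ =>
      (integrable_finsetSum _ fun q _ => integrable_rowDev_sq _ _).const_mul _, Finset.sum_div]
  refine Finset.sum_le_sum fun b _ => ?_
  rw [integral_const_mul, integral_finsetSum _ fun q _ => integrable_rowDev_sq _ _, mul_div_assoc,
    Finset.sum_div]
  gcongr with q
  exact integral_rowDev_sq_le hd _ _

end

/-! ### Moments of the values of the selected tokens. -/

noncomputable section

variable {n d : ℕ}

lemma memLp_pairRow_dotProduct (s : Bool) (k : Fin n) (w : Fin d → ℝ) :
    MemLp (fun p => pairRow p s k ⬝ᵥ w) 2 (pairMeasure n d) := by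
  have h : MemLp (fun v : Fin d → ℝ => v ⬝ᵥ w) 2 (gaussVec d) := by
    rw [memLp_two_iff_integrable_sq (measurable_dotProduct_left w).aestronglyMeasurable]
    exact integrable_dotProduct_pow w 2
  exact h.comp_measurePreserving (measurePreserving_pairRow s k)

lemma integral_pairRow_mul (s s' : Bool) (k k' : Fin n) (w : Fin d → ℝ) :
    ∫ p, (pairRow p s k ⬝ᵥ w) * (pairRow p s' k' ⬝ᵥ w) ∂pairMeasure n d =
      if (s, k) = (s', k') then w ⬝ᵥ w else 0 := by
  have hm := measurable_dotProduct_left w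
  split_ifs with h
  · obtain ⟨rfl, rfl⟩ := Prod.mk.inj h
    simp only [← sq]
    exact ((measurePreserving_pairRow s k).hasLaw.integral_comp
      (f := fun v : Fin d → ℝ => (v ⬝ᵥ w) ^ 2) (hm.pow_const 2).aestronglyMeasurable).trans
      (integral_dotProduct_sq w)
  · refine ((hasLaw_pairRow_pair h).integral_comp
      (f := fun q : (Fin d → ℝ) × (Fin d → ℝ) => (q.1 ⬝ᵥ w) * (q.2 ⬝ᵥ w))
      ((hm.comp measurable_fst).mul (hm.comp measurable_snd)).aestronglyMeasurable).trans ?_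
    rw [integral_prod_mul (f := fun v : Fin d → ℝ => v ⬝ᵥ w) (g := fun v : Fin d → ℝ => v ⬝ᵥ w),
      integral_dotProduct, zero_mul]

lemma integrable_pairRow_fourth (s : Bool) (k : Fin n) (w : Fin d → ℝ) :
    Integrable (fun p => (pairRow p s k ⬝ᵥ w) ^ 4) (pairMeasure n d) :=
  (measurePreserving_pairRow s k).integrable_comp_of_integrable (integrable_dotProduct_pow w 4)

lemma integral_pairRow_fourth (s : Bool) (k : Fin n) (w : Fin d → ℝ) :
    ∫ p, (pairRow p s k ⬝ᵥ w) ^ 4 ∂pairMeasure n d = (w ⬝ᵥ w) ^ 2 * gaussFourth :=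
  ((measurePreserving_pairRow s k).hasLaw.integral_comp (f := fun v : Fin d → ℝ => (v ⬝ᵥ w) ^ 4)
    ((measurable_dotProduct_left w).pow_const 4).aestronglyMeasurable).trans
    (integral_dotProduct_fourth w)

lemma pairMix_dotProduct (ρ : ℝ) (p : Matrix (Fin n) (Fin d) ℝ × Matrix (Fin n) (Fin d) ℝ)
    (b : Bool) (k : Fin n) (w : Fin d → ℝ) :
    pairMix ρ p b k ⬝ᵥ w = ∑ s, mixCoeff ρ b s * (pairRow p s k ⬝ᵥ w) := by
  rw [pairMix_row]
  simp [add_dotProduct]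

lemma memLp_pairMix_dotProduct (ρ : ℝ) (b : Bool) (k : Fin n) (w : Fin d → ℝ) :
    MemLp (fun p => pairMix ρ p b k ⬝ᵥ w) 2 (pairMeasure n d) := by
  simp_rw [pairMix_dotProduct]
  exact memLp_finsetSum _ fun s _ => (memLp_pairRow_dotProduct s k w).const_mul _

lemma continuous_pairMix_dotProduct (ρ : ℝ) (b : Bool) (k : Fin n) (w : Fin d → ℝ) :
    Continuous fun p : Matrix (Fin n) (Fin d) ℝ × Matrix (Fin n) (Fin d) ℝ =>
      pairMix ρ p b k ⬝ᵥ w := by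
  have h : ∀ x : Fin d, Continuous fun
      p : Matrix (Fin n) (Fin d) ℝ × Matrix (Fin n) (Fin d) ℝ => pairMix ρ p b k x :=
    fun x => (continuous_apply_apply k x).comp (continuous_pairMix ρ b)
  unfold dotProduct
  fun_prop

/-- The product of the values of the tokens selected by `κ`. -/
def valueProd (ρ : ℝ) (w : Fin d → ℝ) (κ : Bool → Fin n)
    (p : Matrix (Fin n) (Fin d) ℝ × Matrix (Fin n) (Fin d) ℝ) : ℝ :=
  ∏ b, (pairMix ρ p b (κ b) ⬝ᵥ w)

lemma continuous_valueProd (ρ : ℝ) (w : Fin d → ℝ) (κ : Bool → Fin n) :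
    Continuous (valueProd ρ w κ) :=
  continuous_finsetProd _ fun b _ => continuous_pairMix_dotProduct ρ b (κ b) w

lemma integrable_valueProd (ρ : ℝ) (w : Fin d → ℝ) (κ : Bool → Fin n) :
    Integrable (valueProd ρ w κ) (pairMeasure n d) := by
  have := (memLp_pairMix_dotProduct ρ true (κ true) w).integrable_mul
    (memLp_pairMix_dotProduct ρ false (κ false) w)
  refine this.congr (.of_forall fun p => ?_)
  simp [valueProd]

/-- Values of different tokens are independent and centred; for the same token the values in `X` and
`Y` have covariance `ρ * (w ⬝ᵥ w)`. -/
lemma integral_valueProd {ρ : ℝ} (hρ : ρ ^ 2 < 1) (w : Fin d → ℝ) (κ : Bool → Fin n) :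
    ∫ p, valueProd ρ w κ p ∂pairMeasure n d =
      if κ false = κ true then ρ * (w ⬝ᵥ w) else 0 := by
  have h1 : ∀ p : Matrix (Fin n) (Fin d) ℝ × Matrix (Fin n) (Fin d) ℝ, valueProd ρ w κ p =
      ∑ q : Bool × Bool, (mixCoeff ρ false q.1 * mixCoeff ρ true q.2) *
        ((pairRow p q.1 (κ false) ⬝ᵥ w) * (pairRow p q.2 (κ true) ⬝ᵥ w)) := by
    intro p
    simp only [valueProd, Fintype.prod_bool, pairMix_dotProduct, Fintype.sum_prod_type,
      Fintype.sum_bool]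
    ring
  simp_rw [h1]
  rw [integral_finsetSum]
  · simp_rw [integral_const_mul, integral_pairRow_mul]
    -- The covariance computation for the Gram matrix is reused with a single replica, indexed by
    -- `Unit`.
    have h2 := sum_mixCoeff hρ ((), false) ((), true) (κ false) (κ true)
    have h3 : replicaCorr ρ ((), false) ((), true) = ρ := by simp [replicaCorr]
    rw [h3] at h2
    calc _ = ∑ q : Bool × Bool, mixCoeff ρ false q.1 * mixCoeff ρ true q.2 *
          (if ((), q.1, κ false) = ((), q.2, κ true) then 1 else 0) * (w ⬝ᵥ w) := by
          refine Finset.sum_congr rfl fun q _ => ?_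
          simp only [Prod.mk.injEq, true_and]
          split_ifs <;> simp
      _ = _ := by
          rw [← Finset.sum_mul, h2]
          split_ifs <;> simp
  · exact fun q _ => ((memLp_pairRow_dotProduct q.1 (κ false) w).integrable_mul
      (memLp_pairRow_dotProduct q.2 (κ true) w)).const_mul _

/-- The constant is that of `(x + y) ^ 4 ≤ 8 * (x ^ 4 + y ^ 4)`. Fourth moments of values are needed
because a product of two values is used as a test function in `L²`. -/
lemma pairMix_dotProduct_fourth_le {ρ : ℝ} (hρ : ρ ^ 2 < 1) (w : Fin d → ℝ) (b : Bool) (k : Fin n)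
    (p : Matrix (Fin n) (Fin d) ℝ × Matrix (Fin n) (Fin d) ℝ) :
    (pairMix ρ p b k ⬝ᵥ w) ^ 4 ≤ 8 * ∑ s, (pairRow p s k ⬝ᵥ w) ^ 4 := by
  rw [pairMix_dotProduct]
  have h1 : ∀ s, (mixCoeff ρ b s * (pairRow p s k ⬝ᵥ w)) ^ 4 ≤ (pairRow p s k ⬝ᵥ w) ^ 4 := by
    intro s
    rw [mul_pow]
    have h2 := (sq_le_one_iff_abs_le_one _).2 (abs_mixCoeff_le hρ b s)
    refine mul_le_of_le_one_left (by positivity) ?_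
    calc mixCoeff ρ b s ^ 4 = (mixCoeff ρ b s ^ 2) ^ 2 := by ring
      _ ≤ 1 := pow_le_one₀ (sq_nonneg _) h2
  have h2 := h1 true
  have h3 := h1 false
  simp only [Fintype.sum_bool]
  set x := mixCoeff ρ b true * (pairRow p true k ⬝ᵥ w)
  set y := mixCoeff ρ b false * (pairRow p false k ⬝ᵥ w)
  have h4 : (x + y) ^ 4 ≤ 8 * (x ^ 4 + y ^ 4) := by
    have h5 : (x + y) ^ 2 ≤ 2 * (x ^ 2 + y ^ 2) := by nlinarith [sq_nonneg (x - y)]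
    calc (x + y) ^ 4 = ((x + y) ^ 2) ^ 2 := by ring
      _ ≤ (2 * (x ^ 2 + y ^ 2)) ^ 2 := by gcongr
      _ ≤ 8 * (x ^ 4 + y ^ 4) := by nlinarith [sq_nonneg (x ^ 2 - y ^ 2)]
  linarith

lemma valueProd_sq_le {ρ : ℝ} (hρ : ρ ^ 2 < 1) (w : Fin d → ℝ) (κ : Bool → Fin n)
    (p : Matrix (Fin n) (Fin d) ℝ × Matrix (Fin n) (Fin d) ℝ) :
    valueProd ρ w κ p ^ 2 ≤ ∑ b, 4 * ∑ s, (pairRow p s (κ b) ⬝ᵥ w) ^ 4 := by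
  have h1 := pairMix_dotProduct_fourth_le hρ w true (κ true) p
  have h2 := pairMix_dotProduct_fourth_le hρ w false (κ false) p
  rw [valueProd, Fintype.prod_bool, Fintype.sum_bool]
  set x := pairMix ρ p true (κ true) ⬝ᵥ w
  set y := pairMix ρ p false (κ false) ⬝ᵥ w
  nlinarith [sq_nonneg (x ^ 2 - y ^ 2)]

lemma integrable_valueProd_bound (w : Fin d → ℝ) (κ : Bool → Fin n) :
    Integrable (fun p => ∑ b, 4 * ∑ s, (pairRow p s (κ b) ⬝ᵥ w) ^ 4) (pairMeasure n d) :=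
  integrable_finsetSum _ fun b _ =>
    (integrable_finsetSum _ fun s _ => integrable_pairRow_fourth s (κ b) w).const_mul _

lemma integrable_valueProd_sq {ρ : ℝ} (hρ : ρ ^ 2 < 1) (w : Fin d → ℝ) (κ : Bool → Fin n) :
    Integrable (fun p => valueProd ρ w κ p ^ 2) (pairMeasure n d) := by
  refine (integrable_valueProd_bound w κ).mono'
    ((continuous_valueProd ρ w κ).pow 2).aestronglyMeasurable (.of_forall fun p => ?_)
  rw [Real.norm_eq_abs, abs_of_nonneg (sq_nonneg _)]
  exact valueProd_sq_le hρ w κ p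

lemma integral_valueProd_sq_le {ρ : ℝ} (hρ : ρ ^ 2 < 1) (w : Fin d → ℝ) (κ : Bool → Fin n) :
    ∫ p, valueProd ρ w κ p ^ 2 ∂pairMeasure n d ≤ 16 * ((w ⬝ᵥ w) ^ 2 * gaussFourth) := by
  refine (integral_mono (integrable_valueProd_sq hρ w κ) (integrable_valueProd_bound w κ)
    (valueProd_sq_le hρ w κ)).trans_eq ?_
  rw [integral_finsetSum _ fun b _ =>
    (integrable_finsetSum _ fun s _ => integrable_pairRow_fourth s (κ b) w).const_mul _]
  simp_rw [integral_const_mul]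
  have h : ∀ b, ∫ p, ∑ s, (pairRow p s (κ b) ⬝ᵥ w) ^ 4 ∂pairMeasure n d =
      2 * ((w ⬝ᵥ w) ^ 2 * gaussFourth) := by
    intro b
    rw [integral_finsetSum _ fun s _ => integrable_pairRow_fourth s (κ b) w]
    simp [integral_pairRow_fourth]
  simp_rw [h]
  rw [Fintype.sum_bool]
  ring

end

/-! ### Softmax near its hard limit, and the two selectors. -/

noncomputable section

variable {n : ℕ} {J : Type*} [Fintype J]

lemma softmax_nonneg (v : Fin n → ℝ) (k : Fin n) : 0 ≤ softmax v k :=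
  div_nonneg (Real.exp_pos _).le (Finset.sum_nonneg fun _ _ => (Real.exp_pos _).le)

lemma sum_softmax_le_one (v : Fin n → ℝ) : ∑ k, softmax v k ≤ 1 := by
  simp only [softmax]
  rw [← Finset.sum_div]
  exact div_self_le_one _

lemma softmax_le_one (v : Fin n → ℝ) (k : Fin n) : softmax v k ≤ 1 :=
  (Finset.single_le_sum (fun l _ => softmax_nonneg v l) (Finset.mem_univ k)).trans
    (sum_softmax_le_one v)

lemma continuous_softmax : Continuous (softmax : (Fin n → ℝ) → Fin n → ℝ) := by
  refine continuous_pi fun k => ?_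
  unfold softmax
  refine Continuous.div (by fun_prop) (by fun_prop) fun v => ?_
  exact (Finset.sum_pos (fun l _ => Real.exp_pos (v l)) ⟨k, Finset.mem_univ k⟩).ne'

/-- With `x = n * exp (-H)` the denominator is at most `exp (v k) * (1 + x)`, and `1 / (1 + x) ≥ 1 -
x`. -/
lemma one_sub_le_softmax {v : Fin n → ℝ} {k : Fin n} {H : ℝ} (h : ∀ j, j ≠ k → v j + H < v k) :
    1 - n * Real.exp (-H) ≤ softmax v k := by
  have hsum : ∑ l, Real.exp (v l) ≤ Real.exp (v k) * (1 + n * Real.exp (-H)) := by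
    rw [← Finset.add_sum_erase _ _ (Finset.mem_univ k), mul_add, mul_one]
    gcongr
    calc ∑ l ∈ Finset.univ.erase k, Real.exp (v l)
        ≤ ∑ l ∈ Finset.univ.erase k, Real.exp (v k) * Real.exp (-H) := by
          refine Finset.sum_le_sum fun l hl => ?_
          rw [← Real.exp_add]
          have := h l (Finset.ne_of_mem_erase hl)
          exact Real.exp_le_exp.2 (by linarith)
      _ ≤ ∑ l : Fin n, Real.exp (v k) * Real.exp (-H) :=
          Finset.sum_le_sum_of_subset_of_nonneg (Finset.erase_subset _ _)
            fun _ _ _ => by positivity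
      _ = Real.exp (v k) * (n * Real.exp (-H)) := by
          rw [Finset.sum_const, Finset.card_univ, Fintype.card_fin, nsmul_eq_mul]; ring
  have hpos : 0 < ∑ l, Real.exp (v l) :=
    Finset.sum_pos (fun l _ => Real.exp_pos (v l)) ⟨k, Finset.mem_univ k⟩
  rw [softmax, le_div_iff₀ hpos]
  set x := (n : ℝ) * Real.exp (-H) with hx
  have hx0 : 0 ≤ x := by positivity
  have he := Real.exp_pos (v k)
  by_cases h1 : 1 - x ≤ 0
  · nlinarith
  · push Not at h1
    nlinarith [mul_le_mul_of_nonneg_left hsum h1.le, mul_nonneg he.le (sq_nonneg x)]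

lemma abs_softmax_sub_le {v : Fin n → ℝ} {k : Fin n} {H : ℝ} (h : ∀ j, j ≠ k → v j + H < v k)
    (l : Fin n) : |softmax v l - if l = k then 1 else 0| ≤ n * Real.exp (-H) := by
  have h1 := one_sub_le_softmax h
  split_ifs with hl
  · subst hl
    have := softmax_le_one v l
    rw [abs_le]; constructor <;> linarith
  · have h2 : softmax v l + softmax v k ≤ 1 := by
      rw [← Finset.sum_pair hl]
      exact (Finset.sum_le_univ_sum_of_nonneg fun j => softmax_nonneg v j).trans
        (sum_softmax_le_one v)
    rw [sub_zero, abs_of_nonneg (softmax_nonneg v l)]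
    linarith

lemma exists_mul_exp_neg_lt (c : ℝ) {ε : ℝ} (hε : 0 < ε) : ∃ H ≥ 0, c * Real.exp (-H) < ε := by
  have h : Tendsto (fun H : ℝ => c * Real.exp (-H)) atTop (𝓝 (c * 0)) :=
    (Real.tendsto_exp_neg_atTop_nhds_zero).const_mul c
  rw [mul_zero] at h
  obtain ⟨H, h1, h2⟩ := ((h.eventually_lt_const hε).and (eventually_ge_atTop 0)).exists
  exact ⟨H, h2, h1⟩

/-- The products of the softmax weights form a selector. -/
lemma isSelector_softmax :
    IsSelector fun (κ : J → Fin n) v => ∏ β, softmax (v β) (κ β) where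
  measurable κ := by
    refine Continuous.measurable (continuous_finsetProd _ fun β _ => ?_)
    exact (continuous_apply (κ β)).comp (continuous_softmax.comp (continuous_apply β))
  nonneg κ v := Finset.prod_nonneg fun β _ => softmax_nonneg _ _
  sum_le_one s v := by
    classical
    refine (Finset.sum_le_univ_sum_of_nonneg
      fun κ => Finset.prod_nonneg fun β _ => softmax_nonneg _ _).trans ?_
    -- Summed over all patterns, the products factor into a product of row sums.
    rw [← Fintype.piFinset_univ, ← Finset.prod_univ_sum (fun _ => Finset.univ)
      (fun β k => softmax (v β) k)]
    exact Finset.prod_le_one (fun β _ => Finset.sum_nonneg fun k _ => softmax_nonneg _ _)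
      fun β _ => sum_softmax_le_one _
  near_one ε hε := by
    -- The first threshold makes the error in Bernoulli's inequality at most `ε`. The second keeps
    -- `1 - x` nonnegative, which the first does not ensure when `J` is empty.
    obtain ⟨H, -, hH⟩ := exists_mul_exp_neg_lt (Fintype.card J * n) (lt_min hε one_pos)
    obtain ⟨H', -, hH'⟩ := exists_mul_exp_neg_lt n one_pos
    refine ⟨max H H', fun κ v hv => ?_⟩
    set x := (n : ℝ) * Real.exp (-max H H') with hx
    have hx1 : x ≤ 1 := by
      refine (le_trans ?_ hH'.le)
      rw [hx]; gcongr; exact le_max_right _ _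
    have hx2 : Fintype.card J * x ≤ ε := by
      refine (le_trans ?_ (hH.le.trans (min_le_left _ _)))
      rw [hx, ← mul_assoc]; gcongr; exact le_max_left _ _
    have h1 : ∏ _β : J, (1 - x) ≤ ∏ β, softmax (v β) (κ β) :=
      Finset.prod_le_prod (fun _ _ => by linarith) fun β _ => one_sub_le_softmax (hv β)
    rw [Finset.prod_const, Finset.card_univ] at h1
    have h2 := one_add_mul_le_pow (a := -x) (by linarith) (Fintype.card J)
    rw [← sub_eq_add_neg] at h2
    linarith

/-- The event that the score rows have their unique maxima at `κ` and that the softmax rows are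
within `ε` of the indicators. -/
def hardSet (ε : ℝ) (κ : J → Fin n) : Set (J → Fin n → ℝ) :=
  {v | ∀ β, IsArgmax (v β) (κ β) ∧ ∀ l, |softmax (v β) l - if l = κ β then 1 else 0| < ε}

lemma measurableSet_hardSet (ε : ℝ) (κ : J → Fin n) : MeasurableSet (hardSet ε κ) := by
  have h : hardSet ε κ = ⋂ β, ((fun v : J → Fin n → ℝ => v β) ⁻¹' {u | IsArgmax u (κ β)} ∩
      ⋂ l, {v | |softmax (v β) l - if l = κ β then 1 else 0| < ε}) := by
    ext v; simp [hardSet]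
  rw [h]
  refine MeasurableSet.iInter fun β => MeasurableSet.inter
    ((measurable_pi_apply β) (measurableSet_setOf_isArgmax _)) (MeasurableSet.iInter fun l => ?_)
  have hc : Continuous fun v : J → Fin n → ℝ => softmax (v β) l :=
    (continuous_apply l).comp (continuous_softmax.comp (continuous_apply β))
  exact measurableSet_lt (hc.sub continuous_const).abs.measurable measurable_const

/-- The events are disjoint because an argmax is unique, so at most one indicator is nonzero. With
this selector the mean weights become probabilities of argmax events. -/
lemma isSelector_hardSet {ε : ℝ} (hε : 0 < ε) :
    IsSelector fun (κ : J → Fin n) => (hardSet ε κ).indicator fun _ => 1 where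
  measurable κ := measurable_const.indicator (measurableSet_hardSet ε κ)
  nonneg κ v := Set.indicator_nonneg (fun _ _ => zero_le_one) _
  sum_le_one s v := by
    by_cases hv : ∃ κ ∈ s, v ∈ hardSet ε κ
    · obtain ⟨κ, hκs, hκ⟩ := hv
      rw [Finset.sum_eq_single_of_mem κ hκs]
      · exact Set.indicator_le_self' (fun _ _ => zero_le_one) v
      · intro κ' _ hne
        refine Set.indicator_of_notMem (fun h => hne ?_) _
        exact funext fun β => (h β).1.unique (hκ β).1
    · push Not at hv
      rw [Finset.sum_eq_zero fun κ hκ => Set.indicator_of_notMem (hv κ hκ) _]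
      exact zero_le_one
  near_one δ hδ := by
    obtain ⟨H, hH0, hH⟩ := exists_mul_exp_neg_lt n hε
    refine ⟨H, fun κ v hv => ?_⟩
    rw [Set.indicator_of_mem]
    · linarith
    · exact fun β => ⟨fun j hj => by linarith [hv β j hj],
        fun l => (abs_softmax_sub_le (hv β) l).trans_lt hH⟩

/-- Softmax weights lie in `[0, 1]`, so at tolerance `2` the softmax condition is void and the pure
argmax event remains. -/
lemma mem_hardSet_two {J : Type*} {κ : J → Fin n} {v : J → Fin n → ℝ} :
    v ∈ hardSet 2 κ ↔ ∀ β, IsArgmax (v β) (κ β) := by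
  refine ⟨fun h β => (h β).1, fun h β => ⟨h β, fun l => ?_⟩⟩
  have h1 := softmax_nonneg (v β) l
  have h2 := softmax_le_one (v β) l
  rw [abs_lt]
  split_ifs <;> constructor <;> linarith

end

/-! ### Moments of the conditional stability through replicas. -/

noncomputable section

variable {n d : ℕ} {R : Type*} [Fintype R]

/-- The attention output in the direction `w`, for the weights `W = W_Q W_Kᵀ`. -/
def attnOut (w : Fin d → ℝ) (i : Fin n) (W : Matrix (Fin d) (Fin d) ℝ)
    (X : Matrix (Fin n) (Fin d) ℝ) : ℝ :=
  ∑ k, softmax (scoreMatrix W X i) k * (X k ⬝ᵥ w)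

lemma continuous_attnOut (w : Fin d → ℝ) (i : Fin n) : Continuous fun
    q : Matrix (Fin d) (Fin d) ℝ × Matrix (Fin n) (Fin d) ℝ => attnOut w i q.1 q.2 := by
  refine continuous_finsetSum _ fun k _ => Continuous.mul ?_ ?_
  · exact (continuous_apply k).comp (continuous_softmax.comp
      ((continuous_apply i).comp continuous_scoreMatrix))
  · have h : ∀ x : Fin d, Continuous fun
        q : Matrix (Fin d) (Fin d) ℝ × Matrix (Fin n) (Fin d) ℝ => q.2 k x :=
      fun x => (continuous_apply_apply k x).comp continuous_snd
    unfold dotProduct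
    fun_prop

/-- The noise stability of the attention output for given `W`. -/
def attnStability (ρ : ℝ) (w : Fin d → ℝ) (i : Fin n) (W : Matrix (Fin d) (Fin d) ℝ) : ℝ :=
  ∫ p, ∏ b, attnOut w i W (pairMix ρ p b) ∂pairMeasure n d

/-- The product over all replicas of the values of the tokens selected by `κ`. -/
def replicaValueProd (ρ : ℝ) (w : Fin d → ℝ) (κ : R × Bool → Fin n)
    (p : R → Matrix (Fin n) (Fin d) ℝ × Matrix (Fin n) (Fin d) ℝ) : ℝ :=
  ∏ r, valueProd ρ w (fun b => κ (r, b)) (p r)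

lemma integrable_replicaValueProd (ρ : ℝ) (w : Fin d → ℝ) (κ : R × Bool → Fin n) :
    Integrable (replicaValueProd ρ w κ) (replicaMeasure R n d) :=
  Integrable.fintype_prod fun r => integrable_valueProd ρ w fun b => κ (r, b)

lemma integrable_replicaValueProd_sq {ρ : ℝ} (hρ : ρ ^ 2 < 1) (w : Fin d → ℝ)
    (κ : R × Bool → Fin n) :
    Integrable (fun p => replicaValueProd ρ w κ p ^ 2) (replicaMeasure R n d) := by
  simp_rw [replicaValueProd, ← Finset.prod_pow]
  exact Integrable.fintype_prod (f := fun r q => valueProd ρ w (fun b => κ (r, b)) q ^ 2)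
    fun r => integrable_valueProd_sq hρ w fun b => κ (r, b)

lemma integral_replicaValueProd {ρ : ℝ} (hρ : ρ ^ 2 < 1) (w : Fin d → ℝ) (κ : R × Bool → Fin n) :
    ∫ p, replicaValueProd ρ w κ p ∂replicaMeasure R n d =
      ∏ r, if κ (r, false) = κ (r, true) then ρ * (w ⬝ᵥ w) else 0 := by
  simp only [replicaValueProd, replicaMeasure]
  rw [integral_fintype_prod_eq_prod (f := fun r q => valueProd ρ w (fun b => κ (r, b)) q)]
  simp_rw [integral_valueProd hρ]

lemma gaussFourth_nonneg : 0 ≤ gaussFourth := integral_nonneg fun x => by positivity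

lemma integral_replicaValueProd_sq_le {ρ : ℝ} (hρ : ρ ^ 2 < 1) (w : Fin d → ℝ)
    (κ : R × Bool → Fin n) :
    ∫ p, replicaValueProd ρ w κ p ^ 2 ∂replicaMeasure R n d ≤
      (16 * ((w ⬝ᵥ w) ^ 2 * gaussFourth)) ^ Fintype.card R := by
  simp_rw [replicaValueProd, ← Finset.prod_pow, replicaMeasure]
  rw [integral_fintype_prod_eq_prod (f := fun r q => valueProd ρ w (fun b => κ (r, b)) q ^ 2)]
  refine (Finset.prod_le_prod (fun r _ => integral_nonneg fun q => sq_nonneg _)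
    fun r _ => integral_valueProd_sq_le hρ w fun b => κ (r, b)).trans_eq ?_
  rw [Finset.prod_const, Finset.card_univ]

/-- Expanding the product of the sums over tokens amounts to choosing one token for each copy of the
data. -/
lemma prod_attnOut_eq_sum [DecidableEq R] (ρ : ℝ) (w : Fin d → ℝ) (i : Fin n) (W : Matrix (Fin d) (Fin d) ℝ)
    (p : R → Matrix (Fin n) (Fin d) ℝ × Matrix (Fin n) (Fin d) ℝ) :
    ∏ r, ∏ b, attnOut w i W (pairMix ρ (p r) b) =
      ∑ κ : R × Bool → Fin n, (∏ a, softmax (scoreMatrix W (replicas ρ p a) i) (κ a)) *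
        replicaValueProd ρ w κ p := by
  have h1 : ∏ r, ∏ b, attnOut w i W (pairMix ρ (p r) b) =
      ∏ a : R × Bool, attnOut w i W (replicas ρ p a) := by
    rw [Fintype.prod_prod_type]; rfl
  rw [h1]
  simp only [attnOut]
  rw [Finset.prod_univ_sum, Fintype.piFinset_univ]
  refine Finset.sum_congr rfl fun κ _ => ?_
  rw [Finset.prod_mul_distrib]
  congr 1
  rw [Fintype.prod_prod_type]
  rfl

lemma continuous_attnOut_pairMix {R : Type*} (ρ : ℝ) (w : Fin d → ℝ) (i : Fin n) (r : R) (b : Bool) :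
    Continuous fun q : Matrix (Fin d) (Fin d) ℝ ×
      (R → Matrix (Fin n) (Fin d) ℝ × Matrix (Fin n) (Fin d) ℝ) =>
      attnOut w i q.1 (pairMix ρ (q.2 r) b) := by
  have h1 : Continuous fun q : Matrix (Fin d) (Fin d) ℝ ×
      (R → Matrix (Fin n) (Fin d) ℝ × Matrix (Fin n) (Fin d) ℝ) => q.2 r :=
    (continuous_apply r).comp continuous_snd
  have h2 : Continuous fun q : Matrix (Fin d) (Fin d) ℝ ×
      (R → Matrix (Fin n) (Fin d) ℝ × Matrix (Fin n) (Fin d) ℝ) => pairMix ρ (q.2 r) b :=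
    (continuous_pairMix ρ b).comp h1
  exact Continuous.comp
    (g := fun q : Matrix (Fin d) (Fin d) ℝ × Matrix (Fin n) (Fin d) ℝ => attnOut w i q.1 q.2)
    (f := fun q : Matrix (Fin d) (Fin d) ℝ × (R → Matrix (Fin n) (Fin d) ℝ ×
      Matrix (Fin n) (Fin d) ℝ) => (q.1, pairMix ρ (q.2 r) b))
    (continuous_attnOut w i) (Continuous.prodMk continuous_fst h2)

lemma continuous_prod_attnOut (ρ : ℝ) (w : Fin d → ℝ) (i : Fin n) : Continuous fun
    q : Matrix (Fin d) (Fin d) ℝ × (R → Matrix (Fin n) (Fin d) ℝ × Matrix (Fin n) (Fin d) ℝ) =>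
      ∏ r, ∏ b, attnOut w i q.1 (pairMix ρ (q.2 r) b) :=
  continuous_finsetProd _ fun r _ => continuous_finsetProd _ fun b _ =>
    continuous_attnOut_pairMix ρ w i r b

lemma integrable_prod_attnOut (ρ : ℝ) (w : Fin d → ℝ) (i : Fin n) : Integrable (fun
    q : Matrix (Fin d) (Fin d) ℝ × (R → Matrix (Fin n) (Fin d) ℝ × Matrix (Fin n) (Fin d) ℝ) =>
      ∏ r, ∏ b, attnOut w i q.1 (pairMix ρ (q.2 r) b))
      ((stdGaussianMatrix d d).prod (replicaMeasure R n d)) := by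
  classical
  have hb : Integrable (fun q : Matrix (Fin d) (Fin d) ℝ ×
      (R → Matrix (Fin n) (Fin d) ℝ × Matrix (Fin n) (Fin d) ℝ) =>
      ∑ κ : R × Bool → Fin n, |replicaValueProd ρ w κ q.2|)
      ((stdGaussianMatrix d d).prod (replicaMeasure R n d)) :=
    (integrable_finsetSum _ fun κ _ => (integrable_replicaValueProd ρ w κ).abs).comp_snd _
  refine hb.mono' (continuous_prod_attnOut ρ w i).aestronglyMeasurable (.of_forall fun q => ?_)
  rw [prod_attnOut_eq_sum, Real.norm_eq_abs]
  refine (Finset.abs_sum_le_sum_abs _ _).trans (Finset.sum_le_sum fun κ _ => ?_)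
  rw [abs_mul]
  refine mul_le_of_le_one_left (abs_nonneg _) ?_
  rw [abs_of_nonneg (Finset.prod_nonneg fun a _ => softmax_nonneg _ _)]
  exact Finset.prod_le_one (fun a _ => softmax_nonneg _ _) fun a _ => softmax_le_one _ _

/-- Given `W` the replicas are independent and identically distributed, so powers of a conditional
expectation become expectations of products. -/
lemma integral_prod_attnOut (ρ : ℝ) (w : Fin d → ℝ) (i : Fin n) (W : Matrix (Fin d) (Fin d) ℝ) :
    ∫ p : R → _, ∏ r, ∏ b, attnOut w i W (pairMix ρ (p r) b) ∂replicaMeasure R n d =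
      attnStability ρ w i W ^ Fintype.card R :=
  integral_fintype_prod_eq_pow (fun q => ∏ b, attnOut w i W (pairMix ρ q b))

lemma integrable_attnStability_pow (ρ : ℝ) (w : Fin d → ℝ) (i : Fin n) (r : ℕ) :
    Integrable (fun W => attnStability ρ w i W ^ r) (stdGaussianMatrix d d) := by
  have h := (integrable_prod_attnOut (R := Fin r) ρ w i).integral_prod_left
  simpa only [integral_prod_attnOut, Fintype.card_fin] using h

lemma continuous_replica_scores {R : Type*} (ρ : ℝ) (i : Fin n) : Continuous fun
    (q : (R → Matrix (Fin n) (Fin d) ℝ × Matrix (Fin n) (Fin d) ℝ) × Matrix (Fin d) (Fin d) ℝ)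
      (a : R × Bool) => scoreMatrix q.2 (replicas ρ q.1 a) i := by
  refine continuous_pi fun a => ?_
  have h1 : Continuous fun q : (R → Matrix (Fin n) (Fin d) ℝ × Matrix (Fin n) (Fin d) ℝ) ×
      Matrix (Fin d) (Fin d) ℝ => (q.2, replicas ρ q.1 a) :=
    continuous_snd.prodMk ((continuous_apply a).comp ((continuous_replicas ρ).comp continuous_fst))
  exact (continuous_apply i).comp (continuous_scoreMatrix.comp h1)

lemma stronglyMeasurable_selMean {F : (R × Bool → Fin n) → (R × Bool → Fin n → ℝ) → ℝ}
    (hF : IsSelector F) (ρ : ℝ) (i : Fin n) (κ : R × Bool → Fin n) :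
    StronglyMeasurable fun p : R → Matrix (Fin n) (Fin d) ℝ × Matrix (Fin n) (Fin d) ℝ =>
      selMean F (replicas ρ p) i κ :=
  ((hF.measurable κ).comp
    (continuous_replica_scores ρ i).measurable).stronglyMeasurable.integral_prod_right'

lemma integrable_mul_selMean {F : (R × Bool → Fin n) → (R × Bool → Fin n → ℝ) → ℝ}
    (hF : IsSelector F) (ρ : ℝ) (i : Fin n) (κ : R × Bool → Fin n)
    {Ψ : (R → Matrix (Fin n) (Fin d) ℝ × Matrix (Fin n) (Fin d) ℝ) → ℝ}
    (hΨ : Integrable Ψ (replicaMeasure R n d)) :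
    Integrable (fun p => Ψ p * selMean F (replicas ρ p) i κ) (replicaMeasure R n d) := by
  refine hΨ.mul_bdd (c := 1) (stronglyMeasurable_selMean hF ρ i κ).aestronglyMeasurable
    (.of_forall fun p => ?_)
  rw [Real.norm_eq_abs, abs_of_nonneg (selMean_nonneg hF _ _ _)]
  exact selMean_le_one hF _ _ _

/-- By Fubini `W` is integrated first, with the data fixed; the values do not involve `W`, so only
the softmax weights are averaged. -/
lemma integral_attnStability_pow [DecidableEq R] (ρ : ℝ) (w : Fin d → ℝ) (i : Fin n) :
    ∫ W, attnStability ρ w i W ^ Fintype.card R ∂stdGaussianMatrix d d =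
      ∑ κ : R × Bool → Fin n, ∫ p, replicaValueProd ρ w κ p *
        selMean (fun κ v => ∏ a, softmax (v a) (κ a)) (replicas ρ p) i κ
          ∂replicaMeasure R n d := by
  have hfint := integrable_prod_attnOut (R := R) ρ w i
  have h1 := integral_prod _ hfint
  rw [integral_prod_symm _ hfint] at h1
  simp only [integral_prod_attnOut] at h1
  rw [← h1]
  have h2 : ∀ p : R → Matrix (Fin n) (Fin d) ℝ × Matrix (Fin n) (Fin d) ℝ,
      ∫ W, ∏ r, ∏ b, attnOut w i W (pairMix ρ (p r) b) ∂stdGaussianMatrix d d =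
      ∑ κ : R × Bool → Fin n, replicaValueProd ρ w κ p *
        selMean (fun κ v => ∏ a, softmax (v a) (κ a)) (replicas ρ p) i κ := by
    intro p
    simp_rw [prod_attnOut_eq_sum]
    rw [integral_finsetSum]
    · refine Finset.sum_congr rfl fun κ _ => ?_
      rw [integral_mul_const, mul_comm]
      rfl
    · exact fun κ _ => (isSelector_softmax.integrable (replicas ρ p) i κ).mul_const _
  simp_rw [h2]
  exact integral_finsetSum _ fun κ _ =>
    integrable_mul_selMean isSelector_softmax ρ i κ (integrable_replicaValueProd ρ w κ)

/-- Both factors are products over replicas, so the sum is a power of the sum for one replica. There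
only patterns with `κ false = κ true` contribute, and their probabilities add up to
`patternStability n ρ`. -/
lemma sum_patternProb_mul_integral [DecidableEq R] [NeZero n] {ρ : ℝ} (hρ : ρ ^ 2 < 1)
    (w : Fin d → ℝ) :
    ∑ κ : R × Bool → Fin n, patternProb (limitMeasure R n (ρ ^ 2)) limitScores κ *
        ∫ p, replicaValueProd ρ w κ p ∂replicaMeasure R n d =
      (ρ * patternStability n ρ * (w ⬝ᵥ w)) ^ Fintype.card R := by
  have h1 : ∑ κ : Bool → Fin n, pairPatternProb (ρ ^ 2) κ *
      (if κ false = κ true then ρ * (w ⬝ᵥ w) else 0) =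
      ρ * patternStability n ρ * (w ⬝ᵥ w) := by
    rw [← sum_pairPatternProb hρ, ← (Equiv.boolArrowEquivProd (Fin n)).symm.sum_comp,
      Fintype.sum_prod_type]
    simp only [Equiv.boolArrowEquivProd, Equiv.coe_fn_symm_mk, mul_ite, mul_zero]
    rw [Finset.mul_sum, Finset.sum_mul]
    refine Finset.sum_congr rfl fun k _ => ?_
    simp
    ring
  rw [← h1, ← Finset.card_univ, ← Finset.prod_const, Finset.prod_univ_sum, Fintype.piFinset_univ,
    ← (Equiv.curry R Bool (Fin n)).sum_comp]
  refine Finset.sum_congr rfl fun κ _ => ?_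
  rw [patternProb_limitScores, integral_replicaValueProd hρ, ← Finset.prod_mul_distrib]
  rfl

/-- The moments of the noise stability for given `W` converge. -/
lemma eventually_abs_integral_attnStability_pow_sub_le [NeZero n] {ρ : ℝ} (hρ : ρ ^ 2 < 1) (r : ℕ)
    (B : ℝ) {ε : ℝ} (hε : 0 < ε) :
    ∀ᶠ d in atTop, ∀ (w : Fin d → ℝ) (i : Fin n), w ⬝ᵥ w ≤ B →
      |∫ W, attnStability ρ w i W ^ r ∂stdGaussianMatrix d d -
        (ρ * patternStability n ρ * (w ⬝ᵥ w)) ^ r| ≤ ε := by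
  set N : ℝ := ((Fintype.card (Fin r × Bool → Fin n) : ℕ) : ℝ) with hN
  have hN0 : 0 ≤ N := Nat.cast_nonneg _
  -- The summand `1` keeps the second-moment bound strictly positive, also for `B = 0`.
  have hM : 0 < (16 * (B ^ 2 * gaussFourth)) ^ r + 1 := by
    have := gaussFourth_nonneg
    positivity
  have hev := eventually_abs_integral_mul_selMean_sub_le
    (gramTendsto_replicas (R := Fin r) (n := n) hρ) (isScoreLimit_limitScores hρ)
    isSelector_softmax hM (show 0 < ε / (N + 1) by positivity)
  filter_upwards [hev] with d hd w i hw
  have h1 := integral_attnStability_pow (R := Fin r) ρ w i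
  have h2 := sum_patternProb_mul_integral (R := Fin r) hρ w (n := n)
  rw [Fintype.card_fin] at h1 h2
  rw [h1, ← h2, ← Finset.sum_sub_distrib]
  refine (Finset.abs_sum_le_sum_abs _ _).trans ?_
  have hκ : ∀ κ : Fin r × Bool → Fin n,
      |∫ p, replicaValueProd ρ w κ p *
        selMean (fun κ v => ∏ a, softmax (v a) (κ a)) (replicas ρ p) i κ
          ∂replicaMeasure (Fin r) n d - patternProb (limitMeasure (Fin r) n (ρ ^ 2)) limitScores κ *
        ∫ p, replicaValueProd ρ w κ p ∂replicaMeasure (Fin r) n d| ≤ ε / (N + 1) := by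
    intro κ
    have h3 := hd (replicaValueProd ρ w κ) (integrable_replicaValueProd_sq hρ w κ) ?_ i κ
    · refine le_trans (le_of_eq ?_) h3
      rw [← integral_const_mul, ← integral_sub]
      · congr 1
        refine integral_congr_ae (.of_forall fun p => ?_)
        simp only
        ring
      · exact integrable_mul_selMean isSelector_softmax ρ i κ (integrable_replicaValueProd ρ w κ)
      · exact (integrable_replicaValueProd ρ w κ).const_mul _
    · refine (integral_replicaValueProd_sq_le hρ w κ).trans ?_
      rw [Fintype.card_fin]
      have h4 := gaussFourth_nonneg
      have h5 := dotProduct_self_nonneg' w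
      refine le_trans ?_ (le_add_of_nonneg_right zero_le_one)
      gcongr
  refine (Finset.sum_le_sum fun κ _ => hκ κ).trans ?_
  rw [Finset.sum_const, Finset.card_univ, nsmul_eq_mul, ← hN, mul_div_assoc', div_le_iff₀
    (by positivity)]
  linarith

end

/-! ### The joint law of `(W, X, Z)`: argmax events and comparison with the selected value. -/

noncomputable section

variable {n d : ℕ}

/-- The joint law of `(W, X, Z)`. -/
def jointMeasure (n d : ℕ) : Measure (Matrix (Fin d) (Fin d) ℝ ×
    (Matrix (Fin n) (Fin d) ℝ × Matrix (Fin n) (Fin d) ℝ)) :=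
  (stdGaussianMatrix d d).prod (pairMeasure n d)

instance (n d : ℕ) : IsProbabilityMeasure (jointMeasure n d) := by
  unfold jointMeasure; infer_instance

/-- The `i`-th score rows of `X` and of `Y`. -/
def pairScores (ρ : ℝ) (i : Fin n) (q : Matrix (Fin d) (Fin d) ℝ ×
    (Matrix (Fin n) (Fin d) ℝ × Matrix (Fin n) (Fin d) ℝ)) (b : Bool) : Fin n → ℝ :=
  scoreMatrix q.1 (pairMix ρ q.2 b) i

lemma measurable_pairScores (ρ : ℝ) (i : Fin n) :
    Measurable (pairScores (d := d) ρ i) := by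
  refine Continuous.measurable (continuous_pi fun b => ?_)
  have h1 : Continuous fun q : Matrix (Fin d) (Fin d) ℝ ×
      (Matrix (Fin n) (Fin d) ℝ × Matrix (Fin n) (Fin d) ℝ) => (q.1, pairMix ρ q.2 b) :=
    continuous_fst.prodMk ((continuous_pairMix ρ b).comp continuous_snd)
  exact (continuous_apply i).comp (continuous_scoreMatrix.comp h1)

lemma measurePreserving_const_unit (n d : ℕ) :
    MeasurePreserving (fun p (_ : Unit) => p) (pairMeasure n d) (replicaMeasure Unit n d) :=
  (measurePreserving_funUnique (pairMeasure n d) Unit).symm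

lemma measureReal_pairScores_mem (ρ : ℝ) (i : Fin n) (ε : ℝ) (κ : Bool → Fin n) :
    (jointMeasure n d).real {q | pairScores ρ i q ∈ hardSet ε κ} =
      ∫ p, selMean (fun κ => (hardSet ε κ).indicator fun _ => 1) (replicas ρ p) i
        (fun a : Unit × Bool => κ a.2) ∂replicaMeasure Unit n d := by
  have hm : MeasurableSet {q : Matrix (Fin d) (Fin d) ℝ ×
      (Matrix (Fin n) (Fin d) ℝ × Matrix (Fin n) (Fin d) ℝ) | pairScores ρ i q ∈ hardSet ε κ} :=
    measurable_pairScores ρ i (measurableSet_hardSet ε κ)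
  rw [← (measurePreserving_const_unit n d).integral_comp' (f := (MeasurableEquiv.funUnique Unit
      (Matrix (Fin n) (Fin d) ℝ × Matrix (Fin n) (Fin d) ℝ)).symm),
    ← integral_indicator_one hm, jointMeasure, integral_prod_symm]
  · refine integral_congr_ae (.of_forall fun p => ?_)
    refine integral_congr_ae (.of_forall fun W => ?_)
    have : pairScores ρ i (W, p) ∈ hardSet ε κ ↔ (fun a : Unit × Bool =>
        scoreMatrix W (replicas ρ (fun _ : Unit => p) a) i) ∈ hardSet ε
          (fun a : Unit × Bool => κ a.2) :=
      ⟨fun h a => h a.2, fun h b => h ((), b)⟩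
    by_cases hq : pairScores ρ i (W, p) ∈ hardSet ε κ
    · exact (Set.indicator_of_mem (show (W, p) ∈ {q | _} from hq) _).trans
        (Set.indicator_of_mem (this.1 hq) (fun _ => (1 : ℝ))).symm
    · exact (Set.indicator_of_notMem (show (W, p) ∉ {q | _} from hq) _).trans
        (Set.indicator_of_notMem (fun h => hq (this.2 h)) (fun _ => (1 : ℝ))).symm
  · exact (integrable_const (1 : ℝ)).indicator hm

lemma patternProb_unit (c : ℝ) (κ : Bool → Fin n) :
    patternProb (limitMeasure Unit n c) limitScores (fun a => κ a.2) = pairPatternProb c κ := by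
  rw [patternProb_limitScores]
  simp

lemma sum_pairPatternProb_eq_one [NeZero n] {ρ : ℝ} (hρ : ρ ^ 2 < 1) :
    ∑ κ : Bool → Fin n, pairPatternProb (ρ ^ 2) κ = 1 := by
  rw [← sum_patternProb (isScoreLimit_limitScores (R := Unit) (n := n) hρ),
    ← ((Equiv.punitProd Bool).symm.arrowCongr (Equiv.refl (Fin n))).sum_comp]
  exact Finset.sum_congr rfl fun κ _ => (patternProb_unit _ κ).symm

lemma tendsto_measureReal_hardSet [NeZero n] {ρ : ℝ} (hρ : ρ ^ 2 < 1) (i : Fin n) {ε : ℝ}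
    (hε : 0 < ε) (κ : Bool → Fin n) :
    Tendsto (fun d => (jointMeasure n d).real {q | pairScores ρ i q ∈ hardSet ε κ}) atTop
      (𝓝 (pairPatternProb (ρ ^ 2) κ)) := by
  rw [Metric.tendsto_nhds]
  intro δ hδ
  have hev := eventually_abs_integral_mul_selMean_sub_le
    (gramTendsto_replicas (R := Unit) (n := n) hρ) (isScoreLimit_limitScores hρ)
    (isSelector_hardSet hε) one_pos (half_pos hδ)
  filter_upwards [hev] with d hd
  -- The constant test function turns the averaged estimate into one for the probability of the
  -- pattern.
  have h := hd (fun _ => 1) (by simp) (by simp) i (fun a => κ a.2)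
  simp only [one_mul] at h
  have hfint := integrable_mul_selMean (d := d) (isSelector_hardSet hε) ρ i
    (fun a : Unit × Bool => κ a.2) (integrable_const (1 : ℝ))
  simp only [one_mul] at hfint
  rw [integral_sub hfint (integrable_const _)] at h
  simp only [integral_const, probReal_univ, one_smul, patternProb_unit] at h
  rw [measureReal_pairScores_mem, Real.dist_eq]
  linarith

/-- Both score rows have a unique maximum and the softmax rows are within `ε` of the indicators. -/
def hardEvent (ρ ε : ℝ) (i : Fin n) : Set (Matrix (Fin d) (Fin d) ℝ ×
    (Matrix (Fin n) (Fin d) ℝ × Matrix (Fin n) (Fin d) ℝ)) :=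
  ⋃ κ : Bool → Fin n, {q | pairScores ρ i q ∈ hardSet ε κ}

lemma measurableSet_hardEvent (ρ ε : ℝ) (i : Fin n) :
    MeasurableSet (hardEvent (d := d) ρ ε i) :=
  MeasurableSet.iUnion fun κ => measurable_pairScores ρ i (measurableSet_hardSet ε κ)

lemma measureReal_iUnion_hardSet (ρ ε : ℝ) (i : Fin n) {ι : Type*} [Fintype ι]
    {f : ι → Bool → Fin n} (hf : Function.Injective f) :
    (jointMeasure n d).real (⋃ x, {q | pairScores ρ i q ∈ hardSet ε (f x)}) =
      ∑ x, (jointMeasure n d).real {q | pairScores ρ i q ∈ hardSet ε (f x)} := by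
  refine measureReal_iUnion_fintype ?_
    fun x => measurable_pairScores ρ i (measurableSet_hardSet ε (f x))
  intro x y hxy
  refine Set.disjoint_left.2 fun q h1 h2 => hxy (hf ?_)
  exact funext fun b => (h1 b).1.unique (h2 b).1

lemma tendsto_measureReal_hardEvent [NeZero n] {ρ : ℝ} (hρ : ρ ^ 2 < 1) (i : Fin n) {ε : ℝ}
    (hε : 0 < ε) :
    Tendsto (fun d => (jointMeasure n d).real (hardEvent ρ ε i)) atTop (𝓝 1) := by
  rw [← sum_pairPatternProb_eq_one (n := n) hρ]
  refine Tendsto.congr (fun d => (measureReal_iUnion_hardSet ρ ε i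
    (f := fun κ : Bool → Fin n => κ) Function.injective_id).symm) ?_
  exact tendsto_finsetSum _ fun κ _ => tendsto_measureReal_hardSet hρ i hε κ

lemma integrable_prod_attnOut_joint (ρ : ℝ) (w : Fin d → ℝ) (i : Fin n) :
    Integrable (fun q => ∏ b, attnOut w i q.1 (pairMix ρ q.2 b)) (jointMeasure n d) := by
  have h := (MeasurePreserving.id (stdGaussianMatrix d d)).prod (measurePreserving_const_unit n d)
  have h2 := h.integrable_comp_of_integrable (integrable_prod_attnOut (R := Unit) ρ w i)
  simpa [Function.comp_def, jointMeasure] using h2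

lemma integral_prod_attnOut_joint (ρ : ℝ) (w : Fin d → ℝ) (i : Fin n) :
    ∫ q, ∏ b, attnOut w i q.1 (pairMix ρ q.2 b) ∂jointMeasure n d =
      ∫ W, attnStability ρ w i W ∂stdGaussianMatrix d d :=
  integral_prod _ (integrable_prod_attnOut_joint ρ w i)

lemma memLp_attnOut (w : Fin d → ℝ) (i : Fin n) (W : Matrix (Fin d) (Fin d) ℝ) :
    MemLp (attnOut w i W) 2 (stdGaussianMatrix n d) := by
  have hW : Continuous fun X : Matrix (Fin n) (Fin d) ℝ => scoreMatrix W X := by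
    unfold scoreMatrix; fun_prop
  refine memLp_finsetSum _ fun k _ => ?_
  have h1 : MemLp (fun v : Fin d → ℝ => v ⬝ᵥ w) 2 (gaussVec d) := by
    rw [memLp_two_iff_integrable_sq (measurable_dotProduct_left w).aestronglyMeasurable]
    exact integrable_dotProduct_pow w 2
  have h2 : MemLp (fun X : Matrix (Fin n) (Fin d) ℝ => X k ⬝ᵥ w) 2 (stdGaussianMatrix n d) :=
    h1.comp_measurePreserving (measurePreserving_row k)
  have h3 : Continuous fun X : Matrix (Fin n) (Fin d) ℝ => softmax (scoreMatrix W X i) k :=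
    (continuous_apply k).comp (continuous_softmax.comp ((continuous_apply i).comp hW))
  refine h2.of_le (h3.aestronglyMeasurable.mul h2.aestronglyMeasurable) (.of_forall fun X => ?_)
  rw [norm_mul]
  refine mul_le_of_le_one_left (norm_nonneg _) ?_
  rw [Real.norm_eq_abs, abs_of_nonneg (softmax_nonneg _ _)]
  exact softmax_le_one _ _

/-- The bound `|u| ≤ 1 + u ^ 2` leaves a sum of squares, which Markov's inequality controls through
second moments. -/
lemma abs_attnOut_sub_le {w : Fin d → ℝ} {i k : Fin n} {W : Matrix (Fin d) (Fin d) ℝ}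
    {X : Matrix (Fin n) (Fin d) ℝ} {ε : ℝ}
    (h : ∀ l, |softmax (scoreMatrix W X i) l - if l = k then 1 else 0| < ε) :
    |attnOut w i W X - X k ⬝ᵥ w| ≤ ε * (n + ∑ l, (X l ⬝ᵥ w) ^ 2) := by
  have h1 : attnOut w i W X - X k ⬝ᵥ w =
      ∑ l, (softmax (scoreMatrix W X i) l - if l = k then 1 else 0) * (X l ⬝ᵥ w) := by
    simp only [sub_mul, Finset.sum_sub_distrib, ite_mul, one_mul, zero_mul, Finset.sum_ite_eq',
      Finset.mem_univ, if_true]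
    rfl
  rw [h1]
  refine (Finset.abs_sum_le_sum_abs _ _).trans ?_
  have h2 : ε * (n + ∑ l, (X l ⬝ᵥ w) ^ 2) = ∑ l, ε * (1 + (X l ⬝ᵥ w) ^ 2) := by
    rw [← Finset.mul_sum, Finset.sum_add_distrib]
    simp
  rw [h2]
  refine Finset.sum_le_sum fun l _ => ?_
  rw [abs_mul]
  have h3 : |X l ⬝ᵥ w| ≤ 1 + (X l ⬝ᵥ w) ^ 2 := by
    rw [← sq_abs]; nlinarith [sq_nonneg (|X l ⬝ᵥ w| - 1), abs_nonneg (X l ⬝ᵥ w)]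
  exact mul_le_mul (h l).le h3 (abs_nonneg _) ((abs_nonneg _).trans (h l).le)

lemma integral_sum_pairMix_sq_le {ρ : ℝ} (hρ : ρ ^ 2 < 1) (w : Fin d → ℝ) (b : Bool) :
    ∫ p, ∑ l, (pairMix ρ p b l ⬝ᵥ w) ^ 2 ∂pairMeasure n d ≤ n * (4 * (w ⬝ᵥ w)) := by
  rw [integral_finsetSum _ fun l _ => (memLp_pairMix_dotProduct ρ b l w).integrable_sq]
  have h : ∀ l : Fin n, ∫ p, (pairMix ρ p b l ⬝ᵥ w) ^ 2 ∂pairMeasure n d ≤ 4 * (w ⬝ᵥ w) := by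
    intro l
    have hb : ∀ p : Matrix (Fin n) (Fin d) ℝ × Matrix (Fin n) (Fin d) ℝ,
        (pairMix ρ p b l ⬝ᵥ w) ^ 2 ≤ 2 * ∑ s, (pairRow p s l ⬝ᵥ w) ^ 2 := by
      intro p
      rw [pairMix_dotProduct]
      refine (sq_sum_le_card_mul_sum_sq).trans ?_
      rw [Finset.card_univ, Fintype.card_bool, Nat.cast_ofNat]
      refine mul_le_mul_of_nonneg_left (Finset.sum_le_sum fun s _ => ?_) zero_le_two
      rw [mul_pow]
      exact mul_le_of_le_one_left (sq_nonneg _)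
        ((sq_le_one_iff_abs_le_one _).2 (abs_mixCoeff_le hρ b s))
    refine (integral_mono (memLp_pairMix_dotProduct ρ b l w).integrable_sq
      ((integrable_finsetSum _ fun s _ => (memLp_pairRow_dotProduct s l w).integrable_sq).const_mul
        2) hb).trans_eq ?_
    rw [integral_const_mul,
      integral_finsetSum _ fun s _ => (memLp_pairRow_dotProduct s l w).integrable_sq]
    have h2 : ∀ s, ∫ p, (pairRow p s l ⬝ᵥ w) ^ 2 ∂pairMeasure n d = w ⬝ᵥ w := fun s => by
      simpa [sq] using integral_pairRow_mul s s l l w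
    simp_rw [h2]
    rw [Fintype.sum_bool]
    ring
  refine (Finset.sum_le_sum fun l _ => h l).trans_eq ?_
  simp

lemma mul_measureReal_sum_pairMix_sq_ge_le {ρ : ℝ} (hρ : ρ ^ 2 < 1) (w : Fin d → ℝ) (b : Bool)
    (T : ℝ) :
    T * (jointMeasure n d).real {q | T ≤ ∑ l, (pairMix ρ q.2 b l ⬝ᵥ w) ^ 2} ≤
      n * (4 * (w ⬝ᵥ w)) := by
  have hfint : Integrable (fun p => ∑ l, (pairMix ρ p b l ⬝ᵥ w) ^ 2) (pairMeasure n d) :=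
    integrable_finsetSum _ fun l _ => (memLp_pairMix_dotProduct ρ b l w).integrable_sq
  have h := mul_meas_ge_le_integral_of_nonneg (.of_forall fun p => Finset.sum_nonneg
    fun l _ => sq_nonneg _) hfint T
  refine le_trans (le_of_eq ?_) (h.trans (integral_sum_pairMix_sq_le hρ w b))
  congr 1
  have hc : Continuous fun p : Matrix (Fin n) (Fin d) ℝ × Matrix (Fin n) (Fin d) ℝ =>
      ∑ l, (pairMix ρ p b l ⬝ᵥ w) ^ 2 :=
    continuous_finsetSum _ fun l _ => (continuous_pairMix_dotProduct ρ b l w).pow 2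
  exact (measurePreserving_snd (μ := stdGaussianMatrix d d)
    (ν := pairMeasure n d)).measureReal_preimage
    (measurableSet_le measurable_const hc.measurable).nullMeasurableSet

lemma attention_eq_attnOut (WQ WK WV : Matrix (Fin d) (Fin d) ℝ) (X : Matrix (Fin n) (Fin d) ℝ)
    (i : Fin n) (j : Fin d) :
    attention WQ WK WV X i j = attnOut (fun a => WV a j) i (WQ * WKᵀ) X := by
  rw [attention, Matrix.mul_apply]
  rfl

lemma colNorm_sq (M : Matrix (Fin d) (Fin d) ℝ) (j : Fin d) :
    colNorm M j ^ 2 = (fun a => M a j) ⬝ᵥ fun a => M a j := by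
  rw [colNorm, EuclideanSpace.norm_sq_eq]
  simp [dotProduct, sq]

lemma noiseStability_eq_attnStability (ρ : ℝ) (WQ WK WV : Matrix (Fin d) (Fin d) ℝ) (i : Fin n)
    (j : Fin d) :
    noiseStability ρ (fun A : Matrix (Fin n) (Fin d) ℝ => attention WQ WK WV A i j) =
      attnStability ρ (fun a => WV a j) i (WQ * WKᵀ) := by
  rw [noiseStability, attnStability, pairMeasure]
  refine integral_congr_ae (.of_forall fun p => ?_)
  simp only [attention_eq_attnOut, Fintype.prod_bool]
  exact mul_comm _ _

end

/-! ### Transfer to the given probability space. -/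

noncomputable section

lemma measureReal_preimage_of_hasLaw {Ω E : Type*} [MeasurableSpace Ω] [MeasurableSpace E]
    {P : Measure Ω} {μ : Measure E} {f : Ω → E} (hf : HasLaw f μ P) {s : Set E}
    (hs : MeasurableSet s) : P.real (f ⁻¹' s) = μ.real s := by
  rw [← hf.map_eq, map_measureReal_apply_of_aemeasurable hf.aemeasurable hs]

section Limits

variable {Ω : Type*} [MeasurableSpace Ω] {P : Measure Ω} {n : ℕ} [NeZero n] {ρ : ℝ}
  {V : ∀ d, Ω → Matrix (Fin d) (Fin d) ℝ ×
    (Matrix (Fin n) (Fin d) ℝ × Matrix (Fin n) (Fin d) ℝ)}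

lemma tendsto_measureReal_softmax_near [IsProbabilityMeasure P] (hρ : ρ ^ 2 < 1)
    (hV : ∀ d, HasLaw (V d) (jointMeasure n d) P) (b : Bool) (i : Fin n) {ε : ℝ} (hε : 0 < ε) :
    Tendsto (fun d => P.real {ω | ∃ k, IsArgmax (pairScores ρ i (V d ω) b) k ∧
      ∀ l, |softmax (pairScores ρ i (V d ω) b) l - if l = k then 1 else 0| < ε})
      atTop (𝓝 1) := by
  refine tendsto_of_tendsto_of_tendsto_of_le_of_le (tendsto_measureReal_hardEvent hρ i hε)
    tendsto_const_nhds (fun d => ?_) fun d => measureReal_le_one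
  rw [← measureReal_preimage_of_hasLaw (hV d) (measurableSet_hardEvent ρ ε i)]
  refine measureReal_mono fun ω hω => ?_
  obtain ⟨κ, hκ⟩ := Set.mem_iUnion.1 hω
  exact ⟨κ b, hκ b⟩

lemma eventually_le_measureReal_attnOut_near [IsProbabilityMeasure P] (hρ : ρ ^ 2 < 1)
    (hV : ∀ d, HasLaw (V d) (jointMeasure n d) P) (b : Bool) {B ε δ : ℝ} (hB : 0 < B) (hε : 0 < ε)
    (hδ : 0 < δ) :
    ∀ᶠ d in atTop, ∀ (w : Fin d → ℝ) (i : Fin n), w ⬝ᵥ w ≤ B →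
      1 - δ ≤ P.real {ω | ∃ k, IsArgmax (pairScores ρ i (V d ω) b) k ∧
        |attnOut w i (V d ω).1 (pairMix ρ (V d ω).2 b) -
          pairMix ρ (V d ω).2 b k ⬝ᵥ w| < ε} := by
  have hn : (0 : ℝ) < n := by exact_mod_cast Nat.pos_of_ne_zero (NeZero.ne n)
  -- Markov's inequality with mean at most `4 * n * B` gives the bad event probability at most `δ /
  -- 2`. Off it, softmax tolerance `ε / (n + T)` makes the output error less than `ε`.
  set T : ℝ := 8 * n * B / δ with hT
  have hTpos : 0 < T := by positivity
  have hε' : 0 < ε / (n + T) := by positivity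
  have hev : ∀ᶠ d in atTop, ∀ i : Fin n, 1 - δ / 2 <
      (jointMeasure n d).real (hardEvent ρ (ε / (n + T)) i) :=
    eventually_all.2 fun i => (tendsto_measureReal_hardEvent hρ i hε').eventually_const_lt
      (by linarith)
  filter_upwards [hev] with d hd w i hw
  have h1 := hd i
  have h2 := mul_measureReal_sum_pairMix_sq_ge_le (n := n) hρ w b T
  set Bad : Set (Matrix (Fin d) (Fin d) ℝ × (Matrix (Fin n) (Fin d) ℝ × Matrix (Fin n) (Fin d) ℝ)) :=
    {q | T ≤ ∑ l, (pairMix ρ q.2 b l ⬝ᵥ w) ^ 2} with hBad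
  have hc : Continuous fun q : Matrix (Fin d) (Fin d) ℝ × (Matrix (Fin n) (Fin d) ℝ ×
      Matrix (Fin n) (Fin d) ℝ) => ∑ l, (pairMix ρ q.2 b l ⬝ᵥ w) ^ 2 :=
    continuous_finsetSum _ fun l _ =>
      ((continuous_pairMix_dotProduct ρ b l w).comp continuous_snd).pow 2
  have hBm : MeasurableSet Bad := measurableSet_le measurable_const hc.measurable
  have h3 : (jointMeasure n d).real Bad ≤ δ / 2 := by
    have h4 : T * (jointMeasure n d).real Bad ≤ T * (δ / 2) := by
      refine h2.trans ?_
      have : T * (δ / 2) = n * (4 * B) := by rw [hT]; field_simp; ring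
      rw [this]
      gcongr
    exact le_of_mul_le_mul_left h4 hTpos
  have hdiff := (measurableSet_hardEvent (d := d) ρ (ε / (n + T)) i).diff hBm
  have h5 : 1 - δ ≤ (jointMeasure n d).real (hardEvent ρ (ε / (n + T)) i \ Bad) := by
    have := le_measureReal_sdiff (μ := jointMeasure n d) (s₁ := hardEvent ρ (ε / (n + T)) i)
      (s₂ := Bad)
    linarith
  refine h5.trans ?_
  rw [← measureReal_preimage_of_hasLaw (hV d) hdiff]
  refine measureReal_mono fun ω hω => ?_
  obtain ⟨hω1, hω2⟩ := hω
  obtain ⟨κ, hκ⟩ := Set.mem_iUnion.1 hω1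
  refine ⟨κ b, (hκ b).1, ?_⟩
  refine (abs_attnOut_sub_le (hκ b).2).trans_lt ?_
  have hω3 : ∑ l, (pairMix ρ (V d ω).2 b l ⬝ᵥ w) ^ 2 < T := not_le.1 hω2
  rw [div_mul_eq_mul_div, div_lt_iff₀ (by positivity)]
  gcongr

lemma tendsto_measureReal_same_argmax [IsProbabilityMeasure P] (hρ : ρ ^ 2 < 1)
    (hV : ∀ d, HasLaw (V d) (jointMeasure n d) P) (i : Fin n) :
    Tendsto (fun d => P.real {ω | ∃ k, IsArgmax (pairScores ρ i (V d ω) false) k ∧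
      IsArgmax (pairScores ρ i (V d ω) true) k}) atTop (𝓝 (patternStability n ρ)) := by
  have hf : Function.Injective fun (k : Fin n) (_ : Bool) => k :=
    fun k l h => congrFun h true
  rw [← sum_pairPatternProb hρ]
  refine Tendsto.congr (fun d => ?_) (tendsto_finsetSum Finset.univ fun k _ =>
    tendsto_measureReal_hardSet hρ i two_pos fun _ => k)
  rw [← measureReal_iUnion_hardSet ρ 2 i hf]
  have hm : MeasurableSet (⋃ k : Fin n, {q : Matrix (Fin d) (Fin d) ℝ × (Matrix (Fin n) (Fin d) ℝ ×
      Matrix (Fin n) (Fin d) ℝ) | pairScores ρ i q ∈ hardSet 2 fun _ => k}) :=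
    MeasurableSet.iUnion fun k => measurable_pairScores ρ i (measurableSet_hardSet 2 _)
  rw [← measureReal_preimage_of_hasLaw (hV d) hm]
  congr 1
  ext ω
  simp only [Set.mem_preimage, Set.mem_iUnion, Set.mem_ofPred_eq, mem_hardSet_two, Bool.forall_bool]

lemma eventually_abs_integral_attnOut_sub_le (hρ : ρ ^ 2 < 1)
    (hV : ∀ d, HasLaw (V d) (jointMeasure n d) P) (B : ℝ) {ε : ℝ} (hε : 0 < ε) :
    ∀ᶠ d in atTop, ∀ (w : Fin d → ℝ) (i : Fin n), w ⬝ᵥ w ≤ B →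
      Integrable (fun ω => ∏ b, attnOut w i (V d ω).1 (pairMix ρ (V d ω).2 b)) P ∧
      |∫ ω, ∏ b, attnOut w i (V d ω).1 (pairMix ρ (V d ω).2 b) ∂P -
        ρ * patternStability n ρ * (w ⬝ᵥ w)| ≤ ε := by
  filter_upwards [eventually_abs_integral_attnStability_pow_sub_le (n := n) hρ 1 B hε] with d hd w i hw
  have hfint := integrable_prod_attnOut_joint ρ w i
  have h1 := (hV d).integral_comp hfint.aestronglyMeasurable
  simp only [Function.comp_def, integral_prod_attnOut_joint] at h1
  refine ⟨?_, ?_⟩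
  · rw [← (hV d).map_eq] at hfint
    exact hfint.comp_aemeasurable (hV d).aemeasurable
  · rw [h1]
    simpa using hd w i hw

/-- Second moment method: if the first two moments tend to `a` and `a ^ 2`, the mean square distance
to `a` tends to `0`. -/
lemma eventually_measureReal_attnStability_le [IsProbabilityMeasure P] (hρ : ρ ^ 2 < 1)
    (hV : ∀ d, HasLaw (V d) (jointMeasure n d) P) {B ε δ : ℝ} (hB : 0 < B) (hε : 0 < ε)
    (hδ : 0 < δ) :
    ∀ᶠ d in atTop, ∀ (w : Fin d → ℝ) (i : Fin n), w ⬝ᵥ w ≤ B →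
      P.real {ω | ε ≤ |attnStability ρ w i (V d ω).1 - ρ * patternStability n ρ * (w ⬝ᵥ w)|} ≤
        δ := by
  -- With both moments within `η` of their limits, `m2 - 2 * a * m1 + a ^ 2 = (m2 - a ^ 2) - 2 * a *
  -- (m1 - a)` is at most `(1 + 2 * |a|) * η ≤ K * η`.
  set K : ℝ := 1 + 2 * (|ρ * patternStability n ρ| * B) with hK
  have hKpos : 0 < K := by positivity
  have hη : 0 < ε ^ 2 * δ / K := by positivity
  filter_upwards [eventually_abs_integral_attnStability_pow_sub_le (n := n) hρ 1 B hη,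
    eventually_abs_integral_attnStability_pow_sub_le (n := n) hρ 2 B hη] with d hd1 hd2 w i hw
  set a : ℝ := ρ * patternStability n ρ * (w ⬝ᵥ w) with ha
  have hi1 := integrable_attnStability_pow (n := n) ρ w i 1
  have hi2 := integrable_attnStability_pow (n := n) ρ w i 2
  have h1 := hd1 w i hw
  have h2 := hd2 w i hw
  simp only [pow_one] at hi1 h1
  have haB : |a| ≤ |ρ * patternStability n ρ| * B := by
    rw [ha, abs_mul, abs_of_nonneg (dotProduct_self_nonneg' w)]
    gcongr
  have hexp : ∀ W, (attnStability ρ w i W - a) ^ 2 =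
      attnStability ρ w i W ^ 2 - 2 * a * attnStability ρ w i W + a ^ 2 := fun W => by ring
  have hisq : Integrable (fun W => (attnStability ρ w i W - a) ^ 2) (stdGaussianMatrix d d) := by
    simp_rw [hexp]
    exact (hi2.sub (hi1.const_mul _)).add (integrable_const _)
  have hsq : ∫ W, (attnStability ρ w i W - a) ^ 2 ∂stdGaussianMatrix d d ≤ ε ^ 2 * δ := by
    simp_rw [hexp]
    have hi3 : Integrable (fun W => attnStability ρ w i W ^ 2 - 2 * a * attnStability ρ w i W)
        (stdGaussianMatrix d d) := hi2.sub (hi1.const_mul _)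
    rw [integral_add hi3 (integrable_const _), integral_sub hi2 (hi1.const_mul _), integral_const_mul]
    simp only [integral_const, probReal_univ, one_smul]
    set m1 := ∫ W, attnStability ρ w i W ∂stdGaussianMatrix d d
    set m2 := ∫ W, attnStability ρ w i W ^ 2 ∂stdGaussianMatrix d d
    have h3 : m2 - 2 * a * m1 + a ^ 2 = (m2 - a ^ 2) - 2 * (a * (m1 - a)) := by ring
    have h4 : |a * (m1 - a)| ≤ (|ρ * patternStability n ρ| * B) * (ε ^ 2 * δ / K) := by
      rw [abs_mul]; gcongr
    rw [h3]
    have h5 : K * (ε ^ 2 * δ / K) = ε ^ 2 * δ := mul_div_cancel₀ _ hKpos.ne'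
    have h6 := (abs_le.1 h2).2
    have h7 := (abs_le.1 h4).1
    rw [← h5, hK, add_mul, one_mul, ← hK]
    linarith
  have hW : HasLaw (fun ω => (V d ω).1) (stdGaussianMatrix d d) P :=
    (measurePreserving_fst (μ := stdGaussianMatrix d d) (ν := pairMeasure n d)).fun_comp_hasLaw
      (hV d)
  have hI := hW.integral_comp hisq.aestronglyMeasurable
  simp only [Function.comp_def] at hI
  have hiP : Integrable (fun ω => (attnStability ρ w i (V d ω).1 - a) ^ 2) P := by
    rw [← hW.map_eq] at hisq
    exact hisq.comp_aemeasurable hW.aemeasurable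
  have hM := mul_meas_ge_le_integral_of_nonneg (.of_forall fun ω => sq_nonneg _) hiP (ε ^ 2)
  rw [hI] at hM
  have h8 : P.real {ω | ε ≤ |attnStability ρ w i (V d ω).1 - a|} ≤
      P.real {ω | ε ^ 2 ≤ (attnStability ρ w i (V d ω).1 - a) ^ 2} := by
    refine measureReal_mono fun ω hω => ?_
    have : ε ≤ |attnStability ρ w i (V d ω).1 - a| := hω
    change ε ^ 2 ≤ (attnStability ρ w i (V d ω).1 - a) ^ 2
    rw [← sq_abs (attnStability ρ w i (V d ω).1 - a)]
    gcongr
  have h9 : ε ^ 2 * P.real {ω | ε ^ 2 ≤ (attnStability ρ w i (V d ω).1 - a) ^ 2} ≤ ε ^ 2 * δ :=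
    hM.trans hsq
  exact h8.trans (le_of_mul_le_mul_left h9 (by positivity))

end Limits

end

theorem mainTheorem4 {Ω : Type*} [MeasurableSpace Ω] (P : Measure Ω) [IsProbabilityMeasure P]
    (n : ℕ) (ρ : ℝ) (hρ : ρ ∈ Set.Ioo (-1 : ℝ) 1)
    (WQ WK : ∀ d : ℕ, Ω → Matrix (Fin d) (Fin d) ℝ)
    (X Y Z : ∀ d : ℕ, Ω → Matrix (Fin n) (Fin d) ℝ)
    -- `W = W_Q W_Kᵀ`, `X`, `Z` are independent standard Gaussian matrices
    (hlaw : ∀ d, HasLaw (fun ω => (WQ d ω * (WK d ω)ᵀ, X d ω, Z d ω))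
      ((stdGaussianMatrix d d).prod ((stdGaussianMatrix n d).prod (stdGaussianMatrix n d))) P)
    (hY : ∀ d ω, Y d ω = ρ • X d ω + √(1 - ρ ^ 2) • Z d ω) :
    -- each softmax row converges in probability to the indicator of the argmax of the scores
    (∀ U ∈ ({X, Y} : Set (∀ d : ℕ, Ω → Matrix (Fin n) (Fin d) ℝ)), ∀ i : Fin n, ∀ ε > (0 : ℝ),
      Tendsto (fun d => P.real {ω | ∃ k, IsArgmax (scores (WQ d ω) (WK d ω) (U d ω) i) k ∧
        ∀ l, |attentionMatrix (WQ d ω) (WK d ω) (U d ω) i l - (if l = k then 1 else 0)| < ε})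
        atTop (𝓝 1)) ∧
    -- each output row is asymptotically the value vector of the selected token
    (∀ U ∈ ({X, Y} : Set (∀ d : ℕ, Ω → Matrix (Fin n) (Fin d) ℝ)),
      ∀ B > (0 : ℝ), ∀ ε > (0 : ℝ), ∀ δ > (0 : ℝ), ∀ᶠ d in atTop,
        ∀ (WV : Matrix (Fin d) (Fin d) ℝ) (i : Fin n) (j : Fin d), colNorm WV j ≤ B →
          1 - δ ≤ P.real {ω | ∃ k, IsArgmax (scores (WQ d ω) (WK d ω) (U d ω) i) k ∧
            |attention (WQ d ω) (WK d ω) WV (U d ω) i j - (U d ω * WV) k j| < ε}) ∧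
    -- `s(ρ)` is the limiting probability that the argmax patterns of `X` and `Y` coincide
    (∀ i : Fin n,
      Tendsto (fun d => P.real {ω | ∃ k, IsArgmax (scores (WQ d ω) (WK d ω) (X d ω) i) k ∧
        IsArgmax (scores (WQ d ω) (WK d ω) (Y d ω) i) k}) atTop (𝓝 (patternStability n ρ))) ∧
    -- the stability, in expectation over `W`, `X`, `Z`
    (∀ B > (0 : ℝ), ∀ ε > (0 : ℝ), ∀ᶠ d in atTop,
      ∀ (WV : Matrix (Fin d) (Fin d) ℝ) (i : Fin n) (j : Fin d), colNorm WV j ≤ B →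
        Integrable (fun ω => attention (WQ d ω) (WK d ω) WV (X d ω) i j *
          attention (WQ d ω) (WK d ω) WV (Y d ω) i j) P ∧
        |(∫ ω, attention (WQ d ω) (WK d ω) WV (X d ω) i j *
          attention (WQ d ω) (WK d ω) WV (Y d ω) i j ∂P) -
            ρ * patternStability n ρ * colNorm WV j ^ 2| ≤ ε) ∧
    -- for fixed weights each output coordinate is in `L²` of the Gaussian measure
    (∀ (d : ℕ) (AQ AK WV : Matrix (Fin d) (Fin d) ℝ) (i : Fin n) (j : Fin d),
      MemLp (fun A => attention AQ AK WV A i j) 2 (stdGaussianMatrix n d)) ∧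
    -- the stability for given `W`, in probability over `W`
    (∀ B > (0 : ℝ), ∀ ε > (0 : ℝ), ∀ δ > (0 : ℝ), ∀ᶠ d in atTop,
      ∀ (WV : Matrix (Fin d) (Fin d) ℝ) (i : Fin n) (j : Fin d), colNorm WV j ≤ B →
        P.real {ω | ε ≤ |noiseStability ρ (fun A : Matrix (Fin n) (Fin d) ℝ =>
            attention (WQ d ω) (WK d ω) WV A i j) -
          ρ * patternStability n ρ * colNorm WV j ^ 2|} ≤ δ) := by
  have hρ2 : ρ ^ 2 < 1 := by
    rw [sq_lt_one_iff_abs_lt_one]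
    exact abs_lt.2 hρ
  rcases Nat.eq_zero_or_pos n with rfl | hn
  -- Without rows every claim is vacuous. The limit theorems assume `n ≠ 0`, since an empty score
  -- row has no argmax.
  · exact ⟨fun _ _ i => i.elim0, fun _ _ _ _ _ _ _ _ => .of_forall fun _ _ i => i.elim0,
      fun i => i.elim0, fun _ _ _ _ => .of_forall fun _ _ i => i.elim0,
      fun _ _ _ _ i => i.elim0, fun _ _ _ _ _ _ => .of_forall fun _ _ i => i.elim0⟩
  have : NeZero n := ⟨hn.ne'⟩
  obtain rfl : Y = fun d ω => ρ • X d ω + √(1 - ρ ^ 2) • Z d ω :=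
    funext fun d => funext fun ω => hY d ω
  have hV : ∀ d, HasLaw (fun ω => (WQ d ω * (WK d ω)ᵀ, X d ω, Z d ω)) (jointMeasure n d) P := hlaw
  have hcol : ∀ {d : ℕ} {WV : Matrix (Fin d) (Fin d) ℝ} {j : Fin d} {B : ℝ}, colNorm WV j ≤ B →
      (fun a => WV a j) ⬝ᵥ (fun a => WV a j) ≤ B ^ 2 := by
    intro d WV j B h
    rw [← colNorm_sq]
    exact pow_le_pow_left₀ (norm_nonneg _) h 2
  refine ⟨?_, ?_, fun i => tendsto_measureReal_same_argmax hρ2 hV i, ?_, ?_, ?_⟩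
  · rintro U (rfl | rfl) i ε hε
    · exact tendsto_measureReal_softmax_near hρ2 hV false i hε
    · exact tendsto_measureReal_softmax_near hρ2 hV true i hε
  · rintro U (rfl | rfl) B hB ε hε δ hδ
    · filter_upwards [eventually_le_measureReal_attnOut_near hρ2 hV false (pow_pos hB 2) hε hδ]
        with d hd WV i j hWV
      simp_rw [attention_eq_attnOut]
      exact hd _ i (hcol hWV)
    · filter_upwards [eventually_le_measureReal_attnOut_near hρ2 hV true (pow_pos hB 2) hε hδ]
        with d hd WV i j hWV
      simp_rw [attention_eq_attnOut]
      exact hd _ i (hcol hWV)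
  · intro B _ ε hε
    filter_upwards [eventually_abs_integral_attnOut_sub_le hρ2 hV (B ^ 2) hε] with d hd WV i j hWV
    have h := hd _ i (hcol hWV)
    simp only [Fintype.prod_bool, mul_comm (attnOut _ _ _ (pairMix ρ _ true))] at h
    simp_rw [attention_eq_attnOut, colNorm_sq]
    exact h
  · intro d AQ AK WV i j
    simp_rw [attention_eq_attnOut]
    exact memLp_attnOut _ i _
  · intro B hB ε hε δ hδ
    filter_upwards [eventually_measureReal_attnStability_le hρ2 hV (pow_pos hB 2) hε hδ]
      with d hd WV i j hWV
    simp_rw [noiseStability_eq_attnStability, colNorm_sq]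
    exact hd _ i (hcol hWV)
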